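/- Labelled plane trees. For $k\ge 1$ let $\mathsf{LT}^+_k$ be the set of finite plane trees $\tau$ whose vertices carry strictly positive integer labels, with root label $k$ and with labels of neighbouring vertices differing by at most $1$; $|\tau|$ is the number of edges of $\tau$, and $[\tau]_r$ is the tree formed by its generations $0,\dots,r$. Let $\rho_k^+$ be the probability measure on $\mathsf{LT}^+_k$ that gives to each $\tau$ a mass proportional to $12^{-|\tau|}$. Positive treed bridges. For $p\in\{1,2,\dots\}$, a positive treed bridge of length $2p$ is a pair $(b;T)$, where $b=(x_0,\dots,x_{2p-1})$ is a sequence of non-negative integers with $x_0=0$ and $|x_{i+1}-x_i|=1$ for all $i$ (indices modulo $2p$), and where $T$ assigns to each down-step $i$ of $b$ (an index with $x_{i+1}=x_i-1$) a tree $T(i)\in \mathsf{LT}^+_{x_i}$. A positive treed bridge of infinite length is defined in the same way with $b=(x_i)_{i\in\mathbb Z}$. The local distance between two positive treed bridges $(b;T)$, $(b';T')$ of finite or infinite length is the infimum of $(1+r)^{-1}$ over the integers $r\geq 0$ such that, for all $i\in[-r,r]$, $x_i=x'_i$, $i$ is a down-step of $b$ if and only if it is one of $b'$, and in that case $[T(i)]_r=[T'(i)]_r$.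 Let $\mathcal B_p$ be the random Boltzmann positive treed bridge of length $2p$: it equals $(b;T)$ with probability proportional to $12^{-\sum_i |T(i)|}$, the sum being over the down-steps of $b$. Let $$\mathbf p(n,n-1)=\frac{n}{2(n+2)},\qquad \mathbf p(n,n+1)=\frac{n+4}{2(n+2)}\qquad(n\ge 0).$$ **Proposition.** For each $p\geq 1$, the law of $\mathcal B_p=(X^p;T^p)$ is well defined; $(X^p_0,\dots,X^p_{2p-1})$ is the initial segment of a nearest-neighbour random walk with transition probabilities $\mathbf p$, issued from $0$ and conditioned to be at $0$ at time $2p$, and, conditionally on $X^p$, the trees $T^p(i)$ at the down-steps $i$ of $X^p$ are independent with laws $\rho^+_{X^p_i}$. As $p\to\infty$, $\mathcal B_p$ converges in law, for the local distance, to the random infinite positive treed bridge $\mathcal B_\infty=(X;T)$ whose law exists and is uniquely determined by the following: * $(X_i)_{i\ge 0}$ and $(X_{-i})_{i\ge 0}$ are independent nearest-neighbour random walks with transition probabilities $\mathbf p$, issued from $X_0=0$; * conditionally on $X$, the trees $T(i)$, at the down-steps $i$ of $X$, are independent with laws $\rho^+_{X_i}$. -/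

import Mathlib

open MeasureTheory ProbabilityTheory Filter Topology
open scoped ENNReal

/-- Finite plane trees with natural-number labels: a vertex is its label together with the ordered
list of the subtrees at its children. -/
inductive LTree : Type where
  | node (label : ℕ) (children : List LTree) : LTree

namespace LTree

/-- The label of the root. -/
def rootLabel : LTree → ℕ
  | node k _ => k

/-- The size `|τ|`, that is the number of edges. -/
def size : LTree → ℕ
  | node _ c => (c.map fun t => size t + 1).sum

/-- The tree `[τ]_h` of the generations `0, …, h`. -/
def trunc : ℕ → LTree → LTree
  | 0, node k _ => node k []
  | h + 1, node k c => node k (c.map (trunc h))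

/-- All labels are (strictly) positive, and labels of neighbours differ by at most one. -/
inductive IsPositive : LTree → Prop where
  | node (k : ℕ) (c : List LTree) (hk : 0 < k)
      (hstep : ∀ t ∈ c, t.rootLabel ≤ k + 1 ∧ k ≤ t.rootLabel + 1)
      (hpos : ∀ t ∈ c, IsPositive t) : IsPositive (node k c)

/-- `LT_k^+`: the positive labelled plane trees with root label `k`. -/
def PositiveWithRoot (k : ℕ) : Set LTree := {t | t.IsPositive ∧ t.rootLabel = k}

/-- The Boltzmann weight `12 ^ (-|τ|)`. -/
noncomputable def weight (t : LTree) : ℝ≥0∞ := (12 : ℝ≥0∞)⁻¹ ^ t.size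

open Classical in
/-- The mass `ρ_k^+({τ})` that the Boltzmann probability on `LT_k^+` gives to `τ`
(it is `0` if `τ` is not in `LT_k^+`). -/
noncomputable def rhoPlus (k : ℕ) (t : LTree) : ℝ≥0∞ :=
  if t ∈ PositiveWithRoot k then t.weight / ∑' s : PositiveWithRoot k, s.1.weight else 0

theorem trunc_trunc (t : LTree) (r s : ℕ) (h : r ≤ s) : trunc r (trunc s t) = trunc r t := by
  induction r generalizing s t with
  | zero => cases t with | node k c => cases s <;> simp [trunc]
  | succ r ih =>
    obtain ⟨s, rfl⟩ : ∃ s', s = s' + 1 := ⟨s - 1, by omega⟩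
    cases t with
    | node k c =>
      simp only [trunc, List.map_map, node.injEq, true_and]
      exact List.map_congr_left fun t _ => ih t s (by omega)

end LTree

/-- A positive treed bridge of length `2 p`, where `p = halfLength` is in `{1, 2, …} ∪ {∞}`. The
indices of a finite bridge are read modulo `2 p`: a family indexed by them is given as a
`2 p`-periodic family indexed by `ℤ`. The partial function `tree` is defined exactly at the
down-steps. -/
@[ext]
structure PosTreedBridge where
  halfLength : ℕ∞
  halfLength_ne_zero : halfLength ≠ 0
  label : ℤ → ℕ
  tree : ℤ → Option LTree
  label_zero : label 0 = 0
  label_step : ∀ i, label (i + 1) = label i + 1 ∨ label i = label (i + 1) + 1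
  label_periodic : ∀ p : ℕ, halfLength = p → ∀ i, label (i + 2 * p) = label i
  tree_of_down : ∀ i, label (i + 1) < label i →
    ∃ t ∈ LTree.PositiveWithRoot (label i), tree i = some t
  tree_of_not_down : ∀ i, ¬ label (i + 1) < label i → tree i = none
  tree_periodic : ∀ p : ℕ, halfLength = p → ∀ i, tree (i + 2 * p) = tree i

namespace PosTreedBridge

/-- The labels and the trees, cut at height `r`, coincide at all indices in `[-r, r]`. -/
def Agree (r : ℕ) (B B' : PosTreedBridge) : Prop :=
  ∀ i : ℤ, |i| ≤ r → B.label i = B'.label i ∧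
    (B.tree i).map (LTree.trunc r) = (B'.tree i).map (LTree.trunc r)

/-- The local distance: the infimum of `1 / (1 + r)` over the `r` with `Agree r B B'`. -/
noncomputable def localDist (B B' : PosTreedBridge) : ℝ :=
  ⨅ r : {r : ℕ // Agree r B B'}, (1 + (r : ℕ) : ℝ)⁻¹

theorem Agree.symm {r : ℕ} {B B' : PosTreedBridge} (h : Agree r B B') : Agree r B' B :=
  fun i hi => ⟨(h i hi).1.symm, (h i hi).2.symm⟩

theorem Agree.trans {r : ℕ} {B B' B'' : PosTreedBridge} (h : Agree r B B')
    (h' : Agree r B' B'') : Agree r B B'' :=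
  fun i hi => ⟨(h i hi).1.trans (h' i hi).1, (h i hi).2.trans (h' i hi).2⟩

theorem Agree.mono {r s : ℕ} (hrs : r ≤ s) {B B' : PosTreedBridge} (h : Agree s B B') :
    Agree r B B' := by
  intro i hi
  obtain ⟨h1, h2⟩ := h i (hi.trans (by exact_mod_cast hrs))
  refine ⟨h1, ?_⟩
  have h3 := congrArg (Option.map (LTree.trunc r)) h2
  have h4 : LTree.trunc r ∘ LTree.trunc s = LTree.trunc r :=
    funext fun t => LTree.trunc_trunc t r s hrs
  rwa [Option.map_map, Option.map_map, h4] at h3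

theorem agree_zero (B B' : PosTreedBridge) : Agree 0 B B' := by
  intro i hi
  obtain rfl : i = 0 := by simpa using hi
  rw [B.tree_of_not_down 0 (by simp [B.label_zero]),
    B'.tree_of_not_down 0 (by simp [B'.label_zero]), B.label_zero, B'.label_zero]
  exact ⟨rfl, rfl⟩

theorem localDist_bddBelow (B B' : PosTreedBridge) :
    BddBelow (Set.range fun r : {r : ℕ // Agree r B B'} => (1 + (r : ℕ) : ℝ)⁻¹) :=
  ⟨0, by rintro _ ⟨r, rfl⟩; positivity⟩

theorem localDist_nonneg (B B' : PosTreedBridge) : 0 ≤ localDist B B' :=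
  Real.iInf_nonneg fun _ => by positivity

theorem localDist_le_iff (r : ℕ) (B B' : PosTreedBridge) :
    localDist B B' ≤ (1 + (r : ℝ))⁻¹ ↔ Agree r B B' := by
  constructor
  · intro h
    by_contra hr
    have : Nonempty {r : ℕ // Agree r B B'} := ⟨⟨0, agree_zero B B'⟩⟩
    have hle : (r : ℝ)⁻¹ ≤ localDist B B' := by
      refine le_ciInf fun s => ?_
      have hs : (s : ℕ) + 1 ≤ r := by
        by_contra hlt
        exact hr (s.2.mono (by omega))
      have hs' : (1 + (s : ℕ) : ℝ) ≤ r := by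
        rw [add_comm]; exact_mod_cast hs
      exact inv_anti₀ (by positivity) hs'
    have hr0 : (0 : ℝ) < r := by
      rcases Nat.eq_zero_or_pos r with h0 | h0
      · exact absurd (h0 ▸ agree_zero B B') hr
      · exact_mod_cast h0
    have : (1 + (r : ℝ))⁻¹ < (r : ℝ)⁻¹ := inv_strictAnti₀ hr0 (by linarith)
    linarith
  · intro h
    exact ciInf_le (localDist_bddBelow B B') ⟨r, h⟩

theorem localDist_triangle (B B' B'' : PosTreedBridge) :
    localDist B B'' ≤ localDist B B' + localDist B' B'' := by
  have : Nonempty {r : ℕ // Agree r B B'} := ⟨⟨0, agree_zero B B'⟩⟩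
  have : Nonempty {r : ℕ // Agree r B' B''} := ⟨⟨0, agree_zero B' B''⟩⟩
  unfold localDist
  refine le_ciInf_add_ciInf fun r s => ?_
  have hr : (0 : ℝ) ≤ (1 + (r : ℕ) : ℝ)⁻¹ := by positivity
  have hs : (0 : ℝ) ≤ (1 + (s : ℕ) : ℝ)⁻¹ := by positivity
  rcases le_total (r : ℕ) s with h | h
  · exact ((localDist_le_iff r B B'').2 (r.2.trans (s.2.mono h))).trans (by linarith)
  · exact ((localDist_le_iff s B B'').2 ((r.2.mono h).trans s.2)).trans (by linarith)

theorem localDist_self (B : PosTreedBridge) : localDist B B = 0 := by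
  refine le_antisymm (le_of_forall_pos_le_add fun e he => ?_) (localDist_nonneg B B)
  obtain ⟨n, hn⟩ := exists_nat_one_div_lt he
  have := (localDist_le_iff n B B).2 fun i _ => ⟨rfl, rfl⟩
  rw [one_div, add_comm] at hn
  linarith

/-- The local topology; a finite bridge and its unrolled infinite version are not separated. -/
noncomputable instance : PseudoMetricSpace PosTreedBridge where
  dist := localDist
  dist_self := localDist_self
  dist_comm B B' := by
    have h : ∀ C C' : PosTreedBridge, localDist C C' ≤ localDist C' C := fun C C' => by
      have : Nonempty {r : ℕ // Agree r C' C} := ⟨⟨0, agree_zero C' C⟩⟩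
      exact le_ciInf fun r => (localDist_le_iff r C C').2 r.2.symm
    exact le_antisymm (h B B') (h B' B)
  dist_triangle := localDist_triangle

noncomputable instance : MeasurableSpace PosTreedBridge := borel _

instance : BorelSpace PosTreedBridge := ⟨rfl⟩

/-- `TB_p^+`, for `p` in `{1, 2, …} ∪ {∞}`, with the local topology and its Borel sets. -/
abbrev OfHalfLength (p : ℕ∞) : Type := {B : PosTreedBridge // B.halfLength = p}

/-- The size of a treed bridge of length `2 p`: the sum of the sizes of its trees. -/
def size {p : ℕ} (B : OfHalfLength p) : ℕ :=
  ∑ i ∈ Finset.range (2 * p), (B.1.tree i).elim 0 LTree.size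

/-- The Boltzmann weight `12 ^ (-size)`. -/
noncomputable def weight {p : ℕ} (B : OfHalfLength p) : ℝ≥0∞ := (12 : ℝ≥0∞)⁻¹ ^ size B

/-- The law of `B_p`: the Boltzmann distribution on positive treed bridges of length `2 p`, which
gives to each of them a mass proportional to `12 ^ (-size)`. -/
noncomputable def boltzmannLaw (p : ℕ) : Measure (OfHalfLength p) :=
  Measure.sum fun B => (weight B / ∑' B' : OfHalfLength p, weight B') • Measure.dirac B

end PosTreedBridge

/-- The nearest-neighbour transition probabilities `𝐩(m, n)` on the natural numbers. -/
noncomputable def transProb (m n : ℕ) : ℝ :=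
  if n = m + 1 then ((m : ℝ) + 4) / (2 * ((m : ℝ) + 2))
  else if m = n + 1 then (m : ℝ) / (2 * ((m : ℝ) + 2))
  else 0

/-- The probability that a walk with transition probabilities `𝐩` goes from `i` to `j` in time
`n`. -/
noncomputable def walkProb : ℕ → ℕ → ℕ → ℝ
  | 0, i, j => if i = j then 1 else 0
  | n + 1, i, j => transProb i (i + 1) * walkProb n (i + 1) j +
      transProb i (i - 1) * walkProb n (i - 1) j

/-- Under `μ`, the process `Y` is a random walk with transition probabilities `𝐩` issued from
`0`. -/
def IsPWalk {Ω : Type*} [MeasurableSpace Ω] (μ : Measure Ω) (Y : ℕ → Ω → ℕ) : Prop :=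
  (∀ n, Measurable (Y n)) ∧
  ∀ (n : ℕ) (l : ℕ → ℕ), μ.real {ω | ∀ k ≤ n, Y k ω = l k} =
    if l 0 = 0 then ∏ k ∈ Finset.range n, transProb (l k) (l (k + 1)) else 0

/-- `μ` is the law of `B_∞ = (X; T)`. -/
structure IsLawOfBInfinity (μ : Measure (PosTreedBridge.OfHalfLength ⊤)) : Prop where
  /-- `(X_i)_{i ≥ 0}` is a `𝐩`-walk from `0`. -/
  right_walk : IsPWalk μ fun i B => B.1.label (i : ℤ)
  /-- `(X_{-i})_{i ≥ 0}` is a `𝐩`-walk from `0`. -/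
  left_walk : IsPWalk μ fun i B => B.1.label (-(i : ℤ))
  /-- The two walks are independent. -/
  indep : IndepFun (fun B (i : ℕ) => B.1.label (i : ℤ)) (fun B (i : ℕ) => B.1.label (-(i : ℤ))) μ
  /-- Conditionally on `X`, the trees at the down-steps are independent, of laws `ρ_{X_j}^+`: on
  every event `{X ∈ A}` on which all the indices in the finite set `J` are down-steps, the
  conditional probability given `X` of `T(j) = τ_j` for all `j ∈ J` is the product of the
  `ρ_{X_j}^+({τ_j})`. -/
  trees : ∀ (J : Finset ℤ) (A : Set (ℤ → ℕ)), MeasurableSet A →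
    (∀ x ∈ A, ∀ j ∈ J, x (j + 1) < x j) → ∀ τ : ℤ → LTree,
      μ {B | B.1.label ∈ A ∧ ∀ j ∈ J, B.1.tree j = some (τ j)} =
        ∫⁻ B in {B | B.1.label ∈ A}, ∏ j ∈ J, LTree.rhoPlus (B.1.label j) (τ j) ∂μ

/-! The total weight `w k` of `LT_k^+` is explicit. Splitting a tree at its root gives `w k = 1 / (1
- (w (k-1) + w k + w (k+1)) / 12)` with `w 0 = 0`. An induction on the number of edges gives `w k ≤
2`, and `2 k (k+3) / ((k+1)(k+2))` is the only solution with values in `[0, 2]` (`totalWeight_eq`).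

Summing out the trees, the labels of a Boltzmann bridge have weight `∏ w (x i)` over the down-steps.
With `H n = (n+2)(n+3) √2 ^ n`, one has `𝐩(m, n) = H n / H m * √2/4`, times `w m` for a down-step
(`prod_transProb_eq`). On a closed path the factors `H` cancel, so the labels are a `𝐩`-walk
conditioned to return to `0`, and given the labels the trees are independent with laws `ρ^+`
(`boltzmannLaw_eq_bridgeLaw`).

The local limit of the labels rests on a strong ratio limit theorem. The walk has the reversible
measure `revMeasure`, so by Cauchy-Schwarz the return probabilities are log-convex and decay at most
polynomially; their consecutive ratios therefore increase to `1`. One-step equations and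
reversibility extend this to all starting and ending points (`walkProb_ratio_tendsto`). In a loop of
length `2 p`, the labels in a window around `0` are a beginning and an end of the walk, joined by a
long unobserved stretch. That stretch contributes `revMeasure (c (-n)) / revMeasure 0` in the limit,
exactly the factor that turns the final piece into a walk run backwards from `0`. The limit is a
pair of independent walks (`loopLaw_cylinder_tendsto`).

Finite and infinite bridges read their trees in the same independent field, so once `p > n` the
conditional law of the trees seen in the window `[-n, n]` does not depend on `p` (`bridgeLaw_cell`).
Convergence on the cells of the local distance, which form a π-system and a basis, gives weak
convergence. Uniqueness of the limit law follows from a second π-system, made of the cells with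
whole trees. -/

namespace LTree

/-! ### Countability and truncation of labelled trees. -/

theorem induct {P : LTree → Prop} (h : ∀ k c, (∀ t ∈ c, P t) → P (node k c)) : ∀ t, P t
  | node k c => h k c fun t _ => induct h t

/-- A numbering of the labelled plane trees. -/
def code : LTree → ℕ
  | node k c => Encodable.encode (k, c.map fun t => code t)

theorem code_injective : Function.Injective code := by
  intro t
  induction t using induct with
  | h k c ih =>
    rintro ⟨k', c'⟩ h
    simp only [code, Encodable.encode_inj, Prod.mk.injEq] at h
    obtain ⟨rfl, h⟩ := h
    congr 1
    induction c generalizing c' with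
    | nil => simpa [eq_comm] using h
    | cons t c ihc =>
      cases c' with
      | nil => simp at h
      | cons s c' =>
        simp only [List.map_cons, List.cons.injEq] at h
        rw [ih t (by simp) h.1, ihc (fun t ht => ih t (by simp [ht])) c' h.2]

/-- Countability of the trees makes the full cells, and the bridges of a given finite length,
countable in number. -/
instance : Countable LTree := code_injective.countable

@[simp] theorem size_node (k : ℕ) (c : List LTree) :
    size (node k c) = (c.map fun t => size t + 1).sum := by
  rw [size]

theorem size_lt_of_mem {k : ℕ} {c : List LTree} {t : LTree} (ht : t ∈ c) :
    t.size < (node k c).size := by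
  rw [size_node]
  exact List.single_le_sum (by simp) _ (List.mem_map_of_mem (f := fun t => size t + 1) ht)

theorem trunc_of_size_le (t : LTree) (r : ℕ) (h : t.size ≤ r) : trunc r t = t := by
  induction r generalizing t with
  | zero =>
    obtain ⟨k, c⟩ := t
    cases c with
    | nil => simp [trunc]
    | cons t c => simp at h
  | succ r ih =>
    obtain ⟨k, c⟩ := t
    rw [trunc]
    congr 1
    refine (List.map_congr_left fun t ht => ?_).trans (List.map_id c)
    have := size_lt_of_mem (k := k) ht
    exact ih t (by omega)

/-- The height of a tree is at most its number of edges, so cutting at a height `r ≥ |τ|` changes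
nothing. -/
theorem eq_of_forall_trunc_eq {t s : LTree} (h : ∀ r, trunc r t = trunc r s) : t = s := by
  have := h (max t.size s.size)
  rwa [trunc_of_size_le _ _ (le_max_left _ _), trunc_of_size_le _ _ (le_max_right _ _)] at this

/-- A tree is the label of its root together with the list of its children. -/
def equivProd : LTree ≃ ℕ × List LTree where
  toFun := fun | node k c => (k, c)
  invFun := fun x => node x.1 x.2
  left_inv := fun | node _ _ => rfl
  right_inv := fun _ => rfl

end LTree

/-! ### The total weight of the positive labelled trees. -/

theorem ENNReal.tsum_vector_prod {α : Type*} (f : α → ℝ≥0∞) (n : ℕ) :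
    ∑' v : List.Vector α n, (v.1.map f).prod = (∑' a, f a) ^ n := by
  induction n with
  | zero =>
    rw [tsum_eq_single List.Vector.nil (fun v hv => absurd (Subsingleton.elim _ _) hv)]
    simp [List.Vector.nil]
  | succ n ih =>
    let e : α × List.Vector α n ≃ List.Vector α (n + 1) :=
      { toFun := fun x => x.1 ::ᵥ x.2
        invFun := fun v => (v.head, v.tail)
        left_inv := fun x => by simp
        right_inv := fun v => by simp }
    rw [← e.tsum_eq, ENNReal.tsum_prod', pow_succ', ← ih, ← ENNReal.tsum_mul_right]
    refine tsum_congr fun a => ?_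
    rw [← ENNReal.tsum_mul_left]
    exact tsum_congr fun ⟨v, hv⟩ => by simp [e, List.Vector.cons]

/-- Grading lists by their length gives a geometric series. In `ℝ≥0∞` both sides are `∞` when the
sum is at least `1`, so no convergence condition is needed. -/
theorem ENNReal.tsum_list_prod {α : Type*} (f : α → ℝ≥0∞) :
    ∑' l : List α, (l.map f).prod = (1 - ∑' a, f a)⁻¹ := by
  rw [← ENNReal.tsum_geometric, ← (Equiv.sigmaFiberEquiv (List.length (α := α))).tsum_eq,
    ENNReal.tsum_sigma']
  exact tsum_congr fun n => ENNReal.tsum_vector_prod f n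

namespace LTree

theorem mem_positiveWithRoot {k : ℕ} {t : LTree} :
    t ∈ PositiveWithRoot k ↔ t.IsPositive ∧ t.rootLabel = k := Iff.rfl

/-- The total weight of `LT_k^+`. -/
noncomputable def totalWeight (k : ℕ) : ℝ≥0∞ := ∑' s : PositiveWithRoot k, s.1.weight

open Classical in
/-- The total weight of the trees of `LT_k^+` with fewer than `n` edges. -/
noncomputable def totalWeightLT (n k : ℕ) : ℝ≥0∞ :=
  ∑' t : LTree, if t ∈ PositiveWithRoot k ∧ t.size < n then t.weight else 0

theorem weight_node (k : ℕ) (c : List LTree) :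
    (node k c).weight = (c.map fun t => t.weight / 12).prod := by
  unfold weight
  rw [size_node]
  induction c with
  | nil => simp
  | cons t c ih =>
    simp only [List.map_cons, List.sum_cons, List.prod_cons, pow_add, ih, pow_one, div_eq_mul_inv]

theorem isPositive_node_iff {k : ℕ} {c : List LTree} : (node k c).IsPositive ↔
    0 < k ∧ ∀ t ∈ c, t.IsPositive ∧ t.rootLabel ≤ k + 1 ∧ k ≤ t.rootLabel + 1 :=
  ⟨fun | .node _ _ hk hs hp => ⟨hk, fun t ht => ⟨hp t ht, hs t ht⟩⟩,
    fun h => .node _ _ h.1 (fun t ht => (h.2 t ht).2) fun t ht => (h.2 t ht).1⟩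

open Classical in
theorem totalWeight_eq_tsum (k : ℕ) :
    totalWeight k = ∑' t : LTree, if t ∈ PositiveWithRoot k then t.weight else 0 := by
  rw [totalWeight, tsum_subtype (PositiveWithRoot k) weight]
  exact tsum_congr fun t => by simp [Set.indicator]

theorem prod_map_ite {α : Type*} (f : α → ℝ≥0∞) (P : α → Prop) [DecidablePred P] (c : List α) :
    (c.map fun t => if P t then f t else 0).prod =
      if ∀ t ∈ c, P t then (c.map f).prod else 0 := by
  induction c with
  | nil => simp
  | cons t c ih =>
    simp only [List.map_cons, List.prod_cons, ih, List.forall_mem_cons]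
    by_cases h1 : P t <;> by_cases h2 : ∀ t ∈ c, P t <;> simp [h1, h2]

theorem totalWeight_zero : totalWeight 0 = 0 := by
  rw [totalWeight_eq_tsum]
  refine ENNReal.tsum_eq_zero.2 fun t => if_neg ?_
  obtain ⟨k, c⟩ := t
  rintro ⟨h, h'⟩
  have := (isPositive_node_iff.1 h).1
  simp only [rootLabel] at h'
  omega

open Classical in
/-- A sum over the trees with a given root label is a sum over the lists of their children. -/
theorem tsum_root (k : ℕ) (f : LTree → ℝ≥0∞) :
    ∑' t : LTree, (if t.rootLabel = k then f t else 0) = ∑' c : List LTree, f (node k c) := by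
  rw [← equivProd.symm.tsum_eq, ENNReal.tsum_prod', tsum_eq_single k]
  · exact tsum_congr fun c => if_pos rfl
  · intro j hj
    exact ENNReal.tsum_eq_zero.2 fun c => if_neg hj

open Classical in
/-- A sum over the positive trees whose root label is at most one away from `k + 1`. -/
theorem tsum_neighbours (k : ℕ) (f : LTree → ℝ≥0∞) :
    ∑' t : LTree, (if t.IsPositive ∧ t.rootLabel ≤ k + 1 + 1 ∧ k + 1 ≤ t.rootLabel + 1
      then f t else 0) =
      ∑' t, (if t ∈ PositiveWithRoot k then f t else 0) +
      ∑' t, (if t ∈ PositiveWithRoot (k + 1) then f t else 0) +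
      ∑' t, (if t ∈ PositiveWithRoot (k + 2) then f t else 0) := by
  rw [← ENNReal.tsum_add, ← ENNReal.tsum_add]
  refine tsum_congr fun t => ?_
  simp only [mem_positiveWithRoot]
  by_cases h : t.IsPositive
  · simp only [h, true_and]
    by_cases h0 : t.rootLabel = k
    · simp [h0, show ¬ k + 1 + 1 < k by omega]
    by_cases h1 : t.rootLabel = k + 1
    · simp [h1]
    by_cases h2 : t.rootLabel = k + 2
    · simp [h2]
    rw [if_neg (by omega), if_neg h0, if_neg h1, if_neg h2]
    simp
  · simp [h]

/-- A tree is the list of its subtrees at the root. Each subtree has root label `k`, `k + 1` or `k +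
2` and costs a further `1/12` for its edge to the root. -/
theorem totalWeight_succ (k : ℕ) : totalWeight (k + 1) =
    (1 - (totalWeight k + totalWeight (k + 1) + totalWeight (k + 2)) / 12)⁻¹ := by
  classical
  rw [totalWeight_eq_tsum k, totalWeight_eq_tsum (k + 2), totalWeight_eq_tsum (k + 1),
    ← tsum_neighbours, div_eq_mul_inv, ← ENNReal.tsum_mul_right, ← ENNReal.tsum_list_prod]
  have := tsum_root (k + 1) fun t => if t.IsPositive then t.weight else 0
  simp only [mem_positiveWithRoot]
  calc _ = _ := tsum_congr fun t => ?_
    _ = _ := this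
    _ = _ := tsum_congr fun c => ?_
  · by_cases h : t.IsPositive <;> simp [h]
  · simp only [ite_mul, zero_mul]
    rw [prod_map_ite, weight_node]
    simp only [isPositive_node_iff, Nat.succ_pos, true_and, div_eq_mul_inv]

/-- The subtrees at the root have fewer edges than the tree, and `2` is the fixed point of `s ↦ 1 /
(1 - 3 s / 12)`. The cutoff in size is needed because `totalWeight_succ` alone does not exclude
infinite values. -/
theorem totalWeightLT_le (n k : ℕ) : totalWeightLT n k ≤ 2 := by
  classical
  induction n generalizing k with
  | zero => simp [totalWeightLT]
  | succ n ih =>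
    cases k with
    | zero =>
      refine le_trans ?_ (zero_le (a := 2))
      rw [← totalWeight_zero, totalWeight_eq_tsum]
      exact ENNReal.tsum_le_tsum fun t => by
        split_ifs with h1 h2 <;> simp_all
    | succ k =>
      have h12 : (1 - 6 / 12 : ℝ≥0∞)⁻¹ = 2 := by
        have : (6 / 12 : ℝ≥0∞) = 2⁻¹ := by
          rw [show (12 : ℝ≥0∞) = 6 * 2 by norm_num, ENNReal.div_eq_inv_mul,
            ENNReal.mul_inv (by simp) (by simp), mul_right_comm,
            ENNReal.inv_mul_cancel (by simp) (by simp), one_mul]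
        rw [this, ENNReal.one_sub_inv_two, inv_inv]
      calc totalWeightLT (n + 1) (k + 1)
          = ∑' c, if (node (k + 1) c).IsPositive ∧ (node (k + 1) c).size < n + 1 then
              (node (k + 1) c).weight else 0 := by
            rw [← tsum_root (k + 1) fun t => if t.IsPositive ∧ t.size < n + 1 then t.weight else 0,
              totalWeightLT]
            refine tsum_congr fun t => ?_
            simp only [mem_positiveWithRoot]
            by_cases h : t.rootLabel = k + 1 <;> simp [h]
        _ ≤ ∑' c : List LTree, (c.map fun t => (if t.IsPositive ∧ t.rootLabel ≤ k + 1 + 1 ∧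
              k + 1 ≤ t.rootLabel + 1 then (if t.size < n then t.weight else 0) else 0)
                * 12⁻¹).prod := by
            refine ENNReal.tsum_le_tsum fun c => ?_
            simp only [ite_mul, zero_mul]
            simp only [← ite_and]
            rw [prod_map_ite, weight_node]
            split_ifs with h1 h2
            · simp [div_eq_mul_inv]
            · refine absurd (fun t ht => ⟨(isPositive_node_iff.1 h1.1).2 t ht, ?_⟩) h2
              have := size_lt_of_mem (k := k + 1) ht
              omega
            all_goals simp
        _ = (1 - (totalWeightLT n k + totalWeightLT n (k + 1) + totalWeightLT n (k + 2)) / 12)⁻¹ := by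
            rw [ENNReal.tsum_list_prod, ENNReal.tsum_mul_right, tsum_neighbours, div_eq_mul_inv]
            simp only [totalWeightLT, ← ite_and]
        _ ≤ (1 - 6 / 12)⁻¹ := by
            gcongr
            refine (add_le_add (add_le_add (ih _) (ih _)) (ih _)).trans (by norm_num)
        _ = 2 := h12

theorem totalWeight_le (k : ℕ) : totalWeight k ≤ 2 := by
  classical
  rw [totalWeight_eq_tsum, ENNReal.tsum_eq_iSup_sum]
  refine iSup_le fun s => ?_
  refine le_trans ?_ (totalWeightLT_le (s.sup size + 1) k)
  refine le_trans (Finset.sum_le_sum fun t ht => ?_) (ENNReal.sum_le_tsum s)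
  have := Finset.le_sup (f := size) ht
  simp [Nat.lt_succ_of_le this]

/-- A bounded solution of the recursion which vanishes at `0` is zero. -/
theorem eq_zero_of_convex_of_bounded (e : ℕ → ℝ) (h0 : e 0 = 0) (hnn : ∀ k, 0 ≤ e k)
    (hc : ∀ k, 2 * e (k + 1) ≤ e k + e (k + 2)) (M : ℝ) (hM : ∀ k, e k ≤ M) (k : ℕ) : e k = 0 := by
  -- Increments of a convex sequence increase, so a single positive increment would force linear
  -- growth, against the bound `M`.
  have hinc : ∀ m k, e (m + 1) - e m ≤ e (m + k + 1) - e (m + k) := by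
    intro m k
    induction k with
    | zero => simp
    | succ k ih => 
      have h := hc (m + k)
      rw [← add_assoc, show m + k + 1 + 1 = m + k + 2 from rfl]
      linarith
  have hlin : ∀ m k, e m + k * (e (m + 1) - e m) ≤ e (m + k) := by
    intro m k
    induction k with
    | zero => simp
    | succ k ih =>
      push_cast
      rw [← add_assoc]
      linarith [hinc m k]
  have hdec : ∀ m, e (m + 1) ≤ e m := by
    intro m
    by_contra! hlt
    obtain ⟨n, hn⟩ := exists_nat_gt (M / (e (m + 1) - e m))
    rw [div_lt_iff₀ (by linarith)] at hn
    linarith [hlin m n, hM (m + n), hnn m]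
  refine le_antisymm ?_ (hnn k)
  induction k with
  | zero => exact h0.le
  | succ k ih => exact (hdec k).trans ih

/-- The closed form of the total weight of `LT_k^+`. -/
noncomputable def weightFormula (k : ℕ) : ℝ := 2 * k * (k + 3) / ((k + 1) * (k + 2))

theorem weightFormula_pos (k : ℕ) : 0 < weightFormula (k + 1) := by
  unfold weightFormula
  positivity

theorem weightFormula_nonneg (k : ℕ) : 0 ≤ weightFormula k := by
  unfold weightFormula
  positivity

theorem weightFormula_le (k : ℕ) : weightFormula k ≤ 2 := by
  unfold weightFormula
  rw [div_le_iff₀ (by positivity)]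
  nlinarith

theorem weightFormula_rec (k : ℕ) : weightFormula (k + 1) *
    (1 - (weightFormula k + weightFormula (k + 1) + weightFormula (k + 2)) / 12) = 1 := by
  unfold weightFormula
  push_cast
  field_simp
  ring

theorem totalWeight_ne_top (k : ℕ) : totalWeight k ≠ ∞ :=
  ((totalWeight_le k).trans_lt (by simp)).ne

theorem totalWeight_toReal_le (k : ℕ) : (totalWeight k).toReal ≤ 2 := by
  simpa using ENNReal.toReal_mono (by simp) (totalWeight_le k)

theorem totalWeight_rec_toReal (k : ℕ) : (totalWeight (k + 1)).toReal *
    (1 - ((totalWeight k).toReal + (totalWeight (k + 1)).toReal + (totalWeight (k + 2)).toReal)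
      / 12) = 1 := by
  have hle : (totalWeight k + totalWeight (k + 1) + totalWeight (k + 2)) / 12 ≤ 1 := by
    refine ENNReal.div_le_of_le_mul ?_
    refine (add_le_add (add_le_add (totalWeight_le _) (totalWeight_le _)) (totalWeight_le _)).trans ?_
    norm_num
  have h := congrArg ENNReal.toReal (totalWeight_succ k)
  rw [ENNReal.toReal_inv, ENNReal.toReal_sub_of_le hle (by simp), ENNReal.toReal_div,
    ENNReal.toReal_add (by simp [totalWeight_ne_top]) (totalWeight_ne_top _),
    ENNReal.toReal_add (totalWeight_ne_top _) (totalWeight_ne_top _)] at h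
  simp only [ENNReal.toReal_one, ENNReal.toReal_ofNat] at h
  nth_rw 1 [h]
  refine inv_mul_cancel₀ ?_
  linarith [totalWeight_toReal_le k, totalWeight_toReal_le (k + 1), totalWeight_toReal_le (k + 2)]

/-- The total weight and the closed form solve the same recursion with values in `[0, 2]`. The
absolute difference of two such solutions is convex, vanishes at `0` and is bounded, hence is zero.
-/
theorem totalWeight_eq (k : ℕ) : totalWeight k = ENNReal.ofReal (weightFormula k) := by
  rw [← ENNReal.ofReal_toReal (totalWeight_ne_top k)]
  congr 1
  set W : ℕ → ℝ := fun k => (totalWeight k).toReal with hW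
  have key : ∀ k, |W k - weightFormula k| = 0 := by
    refine eq_zero_of_convex_of_bounded _ ?_ (fun k => abs_nonneg _) (fun k => ?_) 2 fun k => ?_
    · simp [hW, totalWeight_zero, weightFormula]
    · have e1 := totalWeight_rec_toReal k
      have e2 := weightFormula_rec k
      have p1 : 0 ≤ W (k + 1) := ENNReal.toReal_nonneg
      have p2 := weightFormula_nonneg (k + 1)
      have l1 := totalWeight_toReal_le (k + 1)
      have l2 := weightFormula_le (k + 1)
      change W (k + 1) * (1 - (W k + W (k + 1) + W (k + 2)) / 12) = 1 at e1
      change W (k + 1) ≤ 2 at l1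
      generalize W k = a, W (k + 1) = b, W (k + 2) = c, weightFormula k = a',
        weightFormula (k + 1) = b', weightFormula (k + 2) = c' at *
      -- This is `b - b' = b b' (1/b' - 1/b)`, with both inverses given by the recursion.
      have e3 : b - b' = b * b' * ((a - a') + (b - b') + (c - c')) / 12 := by
        linear_combination (-b) * e2 + b' * e1
      have h4 : b * b' ≤ 4 := by nlinarith
      -- Since `b b' ≤ 4`, the coefficient is `1/3`, which is exactly what turns the estimate into
      -- `2 |b - b'| ≤ |a - a'| + |c - c'|`.
      have h5 : |b - b'| ≤ 4 * (|a - a'| + |b - b'| + |c - c'|) / 12 := by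
        calc |b - b'| = b * b' * |(a - a') + (b - b') + (c - c')| / 12 := by
              rw [e3, abs_div, abs_mul, abs_of_nonneg (mul_nonneg p1 p2), ← e3]; norm_num
          _ ≤ _ := by
              gcongr
              exact abs_add_three _ _ _
      linarith
    · rw [abs_le]
      have := totalWeight_toReal_le k
      have p1 : 0 ≤ W k := ENNReal.toReal_nonneg
      constructor <;> linarith [weightFormula_nonneg k, weightFormula_le k]
  exact sub_eq_zero.1 (abs_eq_zero.1 (key k))

end LTree

/-! ### The walk with transition probabilities `𝐩`: reversibility and its kernel. -/

theorem transProb_up (m : ℕ) : transProb m (m + 1) = ((m : ℝ) + 4) / (2 * ((m : ℝ) + 2)) := by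
  simp [transProb]

theorem transProb_down (m : ℕ) : transProb (m + 1) m = ((m : ℝ) + 1) / (2 * ((m : ℝ) + 3)) := by
  rw [transProb, if_neg (by omega), if_pos rfl]
  push_cast
  ring

theorem transProb_pred (m : ℕ) : transProb m (m - 1) = (m : ℝ) / (2 * ((m : ℝ) + 2)) := by
  cases m with
  | zero => simp [transProb]
  | succ m =>
    rw [Nat.add_sub_cancel, transProb_down]
    push_cast
    ring

theorem transProb_zero_zero : transProb 0 0 = 0 := by simp [transProb]

theorem transProb_nonneg (m n : ℕ) : 0 ≤ transProb m n := by
  unfold transProb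
  split_ifs <;> positivity

theorem transProb_up_pos (m : ℕ) : 0 < transProb m (m + 1) := by
  rw [transProb_up]
  positivity

theorem transProb_up_add_pred (m : ℕ) : transProb m (m + 1) + transProb m (m - 1) = 1 := by
  rw [transProb_up, transProb_pred]
  field_simp
  ring

/-- A reversible measure of the walk with transition probabilities `𝐩`. -/
noncomputable def revMeasure (n : ℕ) : ℝ := (n + 1) * (n + 2) ^ 2 * (n + 3)

theorem revMeasure_pos (n : ℕ) : 0 < revMeasure n := by
  unfold revMeasure
  positivity

theorem detailed_balance (n : ℕ) :
    revMeasure n * transProb n (n + 1) = revMeasure (n + 1) * transProb (n + 1) n := by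
  rw [transProb_up, transProb_down, revMeasure, revMeasure]
  push_cast
  field_simp
  ring

theorem detailed_balance_pred (n : ℕ) :
    revMeasure n * transProb n (n - 1) = revMeasure (n - 1) * transProb (n - 1) n := by
  cases n with
  | zero => simp
  | succ n => exact (detailed_balance n).symm

theorem detailed_balance_of_adj {m n : ℕ} (h : n = m + 1 ∨ m = n + 1) :
    revMeasure m * transProb m n = revMeasure n * transProb n m := by
  rcases h with rfl | rfl
  · exact detailed_balance m
  · exact (detailed_balance n).symm

theorem walkProb_nonneg (n i j : ℕ) : 0 ≤ walkProb n i j := by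
  induction n generalizing i with
  | zero => rw [walkProb]; split_ifs <;> norm_num
  | succ n ih =>
    rw [walkProb]
    exact add_nonneg (mul_nonneg (transProb_nonneg _ _) (ih _))
      (mul_nonneg (transProb_nonneg _ _) (ih _))

/-- This splits off the last step, where the definition splits off the first. At `j = 0` the
truncated `j - 1` is `0`, which is harmless because `transProb 0 0 = 0`. -/
theorem walkProb_forward (n i j : ℕ) : walkProb (n + 1) i j =
    walkProb n i (j + 1) * transProb (j + 1) j + walkProb n i (j - 1) * transProb (j - 1) j := by
  induction n generalizing i with
  | zero =>
    simp only [walkProb]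
    rcases Nat.lt_trichotomy (i + 1) j with h | rfl | h
    · simp [show ¬ i + 1 = j by omega, show ¬ i - 1 = j by omega, show ¬ i = j + 1 by omega,
        show ¬ i = j - 1 by omega]
    · simp [show ¬ i - 1 = i + 1 by omega, show ¬ i = i + 1 + 1 by omega]
    · by_cases h1 : i = j + 1
      · subst h1
        simp [show ¬ j + 1 + 1 = j by omega, show ¬ j + 1 = j - 1 by omega]
      · cases i with
        | zero =>
          obtain rfl : j = 0 := by omega
          simp [transProb_zero_zero]
        | succ i =>
          simp [show ¬ i + 1 + 1 = j by omega, show ¬ i = j by omega,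
            show ¬ i + 1 = j - 1 by omega]
  | succ n ih =>
    rw [walkProb, ih, ih, walkProb, walkProb]
    ring

theorem walkProb_symm (n i j : ℕ) :
    revMeasure i * walkProb n i j = revMeasure j * walkProb n j i := by
  induction n generalizing i with
  | zero =>
    simp only [walkProb, eq_comm (a := j)]
    split_ifs with h
    · rw [h]
    · simp
  | succ n ih =>
    rw [walkProb, walkProb_forward]
    linear_combination walkProb n (i + 1) j * detailed_balance i +
      walkProb n (i - 1) j * detailed_balance_pred i + transProb (i + 1) i * ih (i + 1) +
      transProb (i - 1) i * ih (i - 1)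

theorem walkProb_add (n m i j N : ℕ) (h : i + n < N) :
    walkProb (n + m) i j = ∑ k ∈ Finset.range N, walkProb n i k * walkProb m k j := by
  induction n generalizing i with
  | zero =>
    simp only [walkProb, ite_mul, one_mul, zero_mul, Finset.sum_ite_eq, Finset.mem_range, zero_add]
    rw [if_pos (by omega)]
  | succ n ih =>
    rw [show n + 1 + m = n + m + 1 by ring, walkProb, ih _ (by omega), ih _ (by omega),
      Finset.mul_sum, Finset.mul_sum, ← Finset.sum_add_distrib]
    refine Finset.sum_congr rfl fun k _ => ?_
    rw [walkProb]
    ring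

theorem walkProb_sum (n i N : ℕ) (h : i + n < N) :
    ∑ k ∈ Finset.range N, walkProb n i k = 1 := by
  induction n generalizing i with
  | zero =>
    simp only [walkProb, Finset.sum_ite_eq, Finset.mem_range]
    rw [if_pos (by omega)]
  | succ n ih =>
    simp only [walkProb]
    rw [Finset.sum_add_distrib, ← Finset.mul_sum, ← Finset.mul_sum, ih _ (by omega),
      ih _ (by omega), mul_one, mul_one, transProb_up_add_pred]

theorem walkProb_le_one (n i j : ℕ) : walkProb n i j ≤ 1 := by
  rw [← walkProb_sum n i (i + n + j + 1) (by omega)]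
  exact Finset.single_le_sum (f := walkProb n i) (fun k _ => walkProb_nonneg n i k)
    (Finset.mem_range.2 (by omega))

/-! ### Return probabilities and the strong ratio limit theorem. -/

/-- The probability of a return to `0` at time `2 p`. -/
noncomputable def returnProb (p : ℕ) : ℝ := walkProb (2 * p) 0 0

/-- Splitting at time `n` and reversing the second piece expresses the return probability as a
weighted inner product of the laws at times `n` and `m`, ready for Cauchy-Schwarz. -/
theorem walkProb_add_zero (n m N : ℕ) (h : n < N) : walkProb (n + m) 0 0 =
    ∑ k ∈ Finset.range N, walkProb n 0 k * walkProb m 0 k * (revMeasure 0 / revMeasure k) := by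
  rw [walkProb_add n m 0 0 N (by omega)]
  refine Finset.sum_congr rfl fun k _ => ?_
  have hs := walkProb_symm m 0 k
  have := revMeasure_pos k
  field_simp
  rw [mul_assoc, mul_assoc, mul_comm _ (revMeasure 0), hs]
  ring

/-- At time `p` the walk lives on `{0, …, p}`. Cauchy-Schwarz bounds its total mass `1` by the
return probability at time `2 p` times the normalised reversible mass of this set, which is
polynomial in `p`. -/
theorem returnProb_lower (p : ℕ) : 1 ≤ returnProb p * ((p : ℝ) + 3) ^ 5 := by
  have hsum : ∑ k ∈ Finset.range (p + 1), revMeasure k / revMeasure 0 ≤ ((p : ℝ) + 3) ^ 5 := by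
    calc ∑ k ∈ Finset.range (p + 1), revMeasure k / revMeasure 0
        ≤ ∑ k ∈ Finset.range (p + 1), ((p : ℝ) + 3) ^ 4 := by
          refine Finset.sum_le_sum fun k hk => ?_
          have hk' : (k : ℝ) ≤ p := by
            exact_mod_cast Nat.lt_succ_iff.1 (Finset.mem_range.1 hk)
          rw [div_le_iff₀ (revMeasure_pos 0)]
          calc revMeasure k ≤ ((p : ℝ) + 3) * (p + 3) ^ 2 * (p + 3) := by
                unfold revMeasure
                gcongr <;> linarith
            _ ≤ ((p : ℝ) + 3) ^ 4 * revMeasure 0 := by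
                have : 0 ≤ ((p : ℝ) + 3) ^ 4 := by positivity
                simp only [revMeasure]
                norm_num
                nlinarith
      _ = ((p : ℝ) + 1) * (p + 3) ^ 4 := by simp
      _ ≤ _ := by
          rw [pow_succ' _ 4]
          gcongr
          norm_num
  calc (1 : ℝ) = (∑ k ∈ Finset.range (p + 1), walkProb p 0 k) ^ 2 := by
        rw [walkProb_sum _ _ _ (by omega), one_pow]
    _ ≤ (∑ k ∈ Finset.range (p + 1), walkProb p 0 k * walkProb p 0 k *
          (revMeasure 0 / revMeasure k)) *
          ∑ k ∈ Finset.range (p + 1), revMeasure k / revMeasure 0 := by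
        refine Finset.sum_sq_le_sum_mul_sum_of_sq_le_mul _ (fun k _ => ?_) (fun k _ => ?_)
          fun k _ => ?_
        · have := walkProb_nonneg p 0 k
          have := revMeasure_pos k
          have := revMeasure_pos 0
          positivity
        · exact (div_pos (revMeasure_pos _) (revMeasure_pos _)).le
        · have := revMeasure_pos k
          have := revMeasure_pos 0
          field_simp
          exact le_rfl
    _ = returnProb p * ∑ k ∈ Finset.range (p + 1), revMeasure k / revMeasure 0 := by
        rw [← walkProb_add_zero p p _ (by omega), returnProb, two_mul]
    _ ≤ _ := mul_le_mul_of_nonneg_left hsum (walkProb_nonneg _ _ _)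

theorem returnProb_pos (p : ℕ) : 0 < returnProb p := by
  have := returnProb_lower p
  by_contra! h
  have : returnProb p * ((p : ℝ) + 3) ^ 5 ≤ 0 := mul_nonpos_of_nonpos_of_nonneg h (by positivity)
  linarith

/-- Cauchy-Schwarz for the inner product of `walkProb_add_zero`, applied to the laws at times `p`
and `p + 2`. -/
theorem returnProb_logConvex (p : ℕ) :
    returnProb (p + 1) ^ 2 ≤ returnProb p * returnProb (p + 2) := by
  have h1 := walkProb_add_zero p p (p + 3) (by omega)
  have h2 := walkProb_add_zero p (p + 2) (p + 3) (by omega)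
  have h3 := walkProb_add_zero (p + 2) (p + 2) (p + 3) (by omega)
  rw [returnProb, returnProb, returnProb, show 2 * (p + 1) = p + (p + 2) by ring,
    show 2 * (p + 2) = p + 2 + (p + 2) by ring, two_mul, h1, h2, h3]
  refine Finset.sum_sq_le_sum_mul_sum_of_sq_le_mul _ (fun k _ => ?_) (fun k _ => ?_)
    fun k _ => ?_
  · exact mul_nonneg (mul_self_nonneg _) (div_pos (revMeasure_pos _) (revMeasure_pos _)).le
  · exact mul_nonneg (mul_self_nonneg _) (div_pos (revMeasure_pos _) (revMeasure_pos _)).le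
  · exact le_of_eq (by ring)

theorem returnProb_ratio_monotone : Monotone fun p => returnProb (p + 1) / returnProb p := by
  refine monotone_nat_of_le_succ fun p => ?_
  rw [div_le_div_iff₀ (returnProb_pos _) (returnProb_pos _), mul_comm (returnProb (p + 1 + 1)),
    ← sq]
  exact returnProb_logConvex p

theorem returnProb_ratio_le_one (p : ℕ) : returnProb (p + 1) / returnProb p ≤ 1 := by
  by_contra! h
  set c := returnProb (p + 1) / returnProb p with hc
  -- The ratios increase, so a ratio `c > 1` would make the return probabilities grow geometrically
  -- and exceed `1`.
  have hgrow : ∀ m, c ^ m * returnProb p ≤ returnProb (p + m) := by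
    intro m
    induction m with
    | zero => simp
    | succ m ih =>
      have h1 : c ≤ returnProb (p + m + 1) / returnProb (p + m) :=
        returnProb_ratio_monotone (Nat.le_add_right p m)
      rw [le_div_iff₀ (returnProb_pos _)] at h1
      calc c ^ (m + 1) * returnProb p = c * (c ^ m * returnProb p) := by ring
        _ ≤ c * returnProb (p + m) := by gcongr
        _ ≤ _ := h1
  obtain ⟨m, hm⟩ := pow_unbounded_of_one_lt (1 / returnProb p) h
  rw [div_lt_iff₀ (returnProb_pos p)] at hm
  linarith [hgrow m, walkProb_le_one (2 * (p + m)) 0 0,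
    show returnProb (p + m) = walkProb (2 * (p + m)) 0 0 from rfl]

theorem returnProb_ratio_tendsto :
    Tendsto (fun p => returnProb (p + 1) / returnProb p) atTop (𝓝 1) := by
  have hbdd : BddAbove (Set.range fun p => returnProb (p + 1) / returnProb p) :=
    ⟨1, by rintro _ ⟨p, rfl⟩; exact returnProb_ratio_le_one p⟩
  have hlim := tendsto_atTop_ciSup returnProb_ratio_monotone hbdd
  set L := ⨆ p, returnProb (p + 1) / returnProb p with hL
  have hle : ∀ p, returnProb (p + 1) / returnProb p ≤ L := le_ciSup hbdd
  have hL1 : L ≤ 1 := ciSup_le returnProb_ratio_le_one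
  have hL0 : 0 < L := (div_pos (returnProb_pos 1) (returnProb_pos 0)).trans_le (hle 0)
  rcases hL1.eq_or_lt with h | h
  · rwa [h] at hlim
  exfalso
  -- A limit `L < 1` would give geometric decay, against the polynomial lower bound
  -- `returnProb_lower`.
  have hgeom : ∀ p, returnProb p ≤ L ^ p := by
    intro p
    induction p with
    | zero => simpa [returnProb] using walkProb_le_one 0 0 0
    | succ p ih =>
      have h1 := hle p
      rw [div_le_iff₀ (returnProb_pos p)] at h1
      calc returnProb (p + 1) ≤ L * returnProb p := h1
        _ ≤ L * L ^ p := by gcongr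
        _ = L ^ (p + 1) := by ring
  have hz := tendsto_pow_const_mul_const_pow_of_lt_one 5 hL0.le h
  have hz' := hz.comp (tendsto_add_atTop_nat 3)
  have hge : ∀ p : ℕ, L ^ 3 ≤ ((p + 3 : ℕ) : ℝ) ^ 5 * L ^ (p + 3) := by
    intro p
    have h1 := returnProb_lower p
    have h2 : returnProb p * ((p : ℝ) + 3) ^ 5 ≤ L ^ p * ((p : ℝ) + 3) ^ 5 := by
      gcongr
      exact hgeom p
    calc L ^ 3 = 1 * L ^ 3 := by ring
      _ ≤ (L ^ p * ((p : ℝ) + 3) ^ 5) * L ^ 3 := by gcongr; linarith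
      _ = _ := by push_cast; ring
  have := ge_of_tendsto' hz' hge
  linarith [pow_pos hL0 3]

theorem returnProb_shift_tendsto (s : ℕ) :
    Tendsto (fun p => returnProb (p + s) / returnProb p) atTop (𝓝 1) := by
  induction s with
  | zero => simp [div_self (returnProb_pos _).ne']
  | succ s ih =>
    have := ih.mul (returnProb_ratio_tendsto.comp (tendsto_add_atTop_nat s))
    rw [one_mul] at this
    refine this.congr fun p => ?_
    have := returnProb_pos p
    have := returnProb_pos (p + s)
    simp only [Function.comp_apply]
    rw [← add_assoc]
    field_simp

/-- The one-step equation at `a` expresses the kernel from `a + 1` through those from `a` and `a -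
1`. The limit stays `c` because constants are harmonic. -/
theorem walkProb_ratio_tendsto_of_zero (b : ℕ) (c : ℝ)
    (h : Tendsto (fun p => walkProb (2 * p + b) 0 b / returnProb p) atTop (𝓝 c)) (a : ℕ) :
    Tendsto (fun p => walkProb (2 * p + a + b) a b / returnProb p) atTop (𝓝 c) := by
  -- Two more units of time do not change the limit, since consecutive return probabilities have
  -- ratio tending to `1`.
  have shift : ∀ a', Tendsto (fun p => walkProb (2 * p + a' + b) a' b / returnProb p) atTop (𝓝 c) →
      Tendsto (fun p => walkProb (2 * (p + 1) + a' + b) a' b / returnProb p) atTop (𝓝 c) := by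
    intro a' ha'
    have := (ha'.comp (tendsto_add_atTop_nat 1)).mul returnProb_ratio_tendsto
    rw [mul_one] at this
    refine this.congr fun p => ?_
    have := returnProb_pos p
    have := returnProb_pos (p + 1)
    simp only [Function.comp_apply]
    field_simp
  induction a using Nat.strong_induction_on with
  | _ a ih =>
    cases a with
    | zero => simpa using h
    | succ a =>
      have h1 := shift a (ih a (by omega))
      have h2 : Tendsto (fun p => transProb a (a - 1) *
          (walkProb (2 * p + a + 1 + b) (a - 1) b / returnProb p)) atTop
          (𝓝 (transProb a (a - 1) * c)) := by
        cases a with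
        | zero => simp [transProb_zero_zero]
        | succ a' =>
          refine (((shift a' (ih a' (by omega))).const_mul _)).congr fun p => ?_
          rw [show 2 * (p + 1) + a' + b = 2 * p + (a' + 1) + 1 + b by ring, Nat.add_sub_cancel]
      have h3 := (h1.sub h2).const_mul (transProb a (a + 1))⁻¹
      have hup := transProb_up_pos a
      rw [show (transProb a (a + 1))⁻¹ * (c - transProb a (a - 1) * c) = c by
        rw [inv_mul_eq_iff_eq_mul₀ hup.ne']
        linear_combination (-c) * transProb_up_add_pred a] at h3
      refine h3.congr fun p => ?_
      rw [show 2 * (p + 1) + a + b = 2 * p + a + 1 + b + 1 by ring, walkProb,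
        show 2 * p + (a + 1) + b = 2 * p + a + 1 + b by ring]
      have := returnProb_pos p
      field_simp
      ring

/-- The strong ratio limit theorem for the walk with transition probabilities `𝐩`. -/
theorem walkProb_ratio_tendsto (a b : ℕ) :
    Tendsto (fun p => walkProb (2 * p + a + b) a b / returnProb p) atTop
      (𝓝 (revMeasure b / revMeasure 0)) := by
  refine walkProb_ratio_tendsto_of_zero b _ ?_ a
  -- The starting point is first moved from `0` to `b`, with end point `0`. Reversibility then
  -- exchanges the two, which produces the factor `revMeasure b / revMeasure 0`.
  have h0 : Tendsto (fun p => walkProb (2 * p + b) b 0 / returnProb p) atTop (𝓝 1) := by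
    refine walkProb_ratio_tendsto_of_zero 0 1 ?_ b
    refine tendsto_const_nhds.congr fun p => ?_
    exact (div_self (returnProb_pos p).ne').symm
  have := h0.const_mul (revMeasure b / revMeasure 0)
  rw [mul_one] at this
  refine this.congr fun p => ?_
  have h1 := walkProb_symm (2 * p + b) 0 b
  have := revMeasure_pos 0
  have := returnProb_pos p
  field_simp
  linarith

/-- The strong ratio limit theorem, with a fixed number of steps removed. -/
theorem walkProb_ratio_tendsto_sub (a b d : ℕ) (hd : Even (a + b + d)) :
    Tendsto (fun p => walkProb (2 * p - d) a b / returnProb p) atTop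
      (𝓝 (revMeasure b / revMeasure 0)) := by
  obtain ⟨s, hs⟩ := hd
  rw [← tendsto_add_atTop_iff_nat s]
  have := (walkProb_ratio_tendsto a b).mul ((returnProb_shift_tendsto s).inv₀ one_ne_zero)
  rw [inv_one, mul_one] at this
  refine this.congr fun p => ?_
  rw [show 2 * (p + s) - d = 2 * p + a + b by omega]
  have := returnProb_pos p
  have := returnProb_pos (p + s)
  field_simp

/-! ### The Doob transform. -/

/-- The Doob transform between the weights of the bridges and the transition probabilities. -/
theorem prod_transProb_eq (x : ℕ → ℕ) (hx : ∀ i, x (i + 1) = x i + 1 ∨ x i = x (i + 1) + 1)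
    (n : ℕ) : ∏ i ∈ Finset.range n, transProb (x i) (x (i + 1)) =
      ((x n + 2) * (x n + 3) * √2 ^ x n) / ((x 0 + 2) * (x 0 + 3) * √2 ^ x 0) * (√2 / 4) ^ n *
      ∏ i ∈ Finset.range n,
        (if x (i + 1) < x i then LTree.weightFormula (x i) else 1) := by
  induction n with
  | zero =>
    have : ((x 0 + 2) * (x 0 + 3) * √2 ^ x 0 : ℝ) ≠ 0 := by positivity
    simp [div_self this]
  | succ n ih =>
    rw [Finset.prod_range_succ, Finset.prod_range_succ, ih]
    have h2 : √2 * √2 = (2 : ℝ) := Real.mul_self_sqrt (by norm_num)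
    have h2' : √2 ^ 2 = (2 : ℝ) := by rw [sq, h2]
    have h0 : (0 : ℝ) < √2 := by positivity
    generalize ∏ i ∈ Finset.range n,
        (if x (i + 1) < x i then LTree.weightFormula (x i) else 1) = P
    -- With `H n = (n+2)(n+3) √2 ^ n`, the two cases check `H (n+1) / H n * √2/4 = 𝐩(n, n+1)` and `H
    -- n / H (n+1) * √2/4 * w (n+1) = 𝐩(n+1, n)`, where `w` is `weightFormula`.
    rcases hx n with h | h
    · rw [h, if_neg (by omega), transProb_up, pow_succ (√2 / 4) n, pow_succ √2 (x n)]
      push_cast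
      field_simp
      rw [h2']
      ring
    · rw [h, if_pos (by omega), transProb_down, pow_succ (√2 / 4) n, pow_succ √2 (x (n + 1)),
        LTree.weightFormula]
      push_cast
      field_simp
      ring

theorem prod_transProb_closed (x : ℕ → ℕ) (hx : ∀ i, x (i + 1) = x i + 1 ∨ x i = x (i + 1) + 1)
    (n : ℕ) (hn : x n = x 0) : ∏ i ∈ Finset.range n, transProb (x i) (x (i + 1)) =
      (√2 / 4) ^ n * ∏ i ∈ Finset.range n,
        (if x (i + 1) < x i then LTree.weightFormula (x i) else 1) := by
  rw [prod_transProb_eq x hx n, hn, div_self (by positivity), one_mul]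

/-! ### The local topology, its cells and its Borel sets. -/

namespace PosTreedBridge

theorem agree_refl (r : ℕ) (B : PosTreedBridge) : Agree r B B := fun _ _ => ⟨rfl, rfl⟩

theorem isOpen_iff_agree {G : Set PosTreedBridge} :
    IsOpen G ↔ ∀ B ∈ G, ∃ r, ∀ B', Agree r B' B → B' ∈ G := by
  rw [Metric.isOpen_iff]
  refine forall₂_congr fun B _ => ⟨?_, ?_⟩
  · rintro ⟨ε, hε, h⟩
    obtain ⟨n, hn⟩ := exists_nat_one_div_lt hε
    refine ⟨n, fun B' hB' => h (Metric.mem_ball.2 (lt_of_le_of_lt ?_ hn))⟩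
    rw [one_div, add_comm]
    exact (localDist_le_iff n B' B).2 hB'
  · rintro ⟨r, h⟩
    refine ⟨(1 + (r : ℝ))⁻¹, by positivity, fun B' hB' => h B' ?_⟩
    exact (localDist_le_iff r B' B).1 (Metric.mem_ball.1 hB').le

/-- The class of the bridges which agree with `C` up to level `r`. -/
def cell (r : ℕ) (C : PosTreedBridge) : Set PosTreedBridge := {B | Agree r B C}

theorem isOpen_cell (r : ℕ) (C : PosTreedBridge) : IsOpen (cell r C) :=
  isOpen_iff_agree.2 fun _ hB => ⟨r, fun _ hB' => hB'.trans hB⟩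

/-- The relations `Agree r` are equivalence relations, finer as `r` grows, so two cells that meet
are nested. -/
theorem isPiSystem_cells : IsPiSystem {s | ∃ r C, s = cell r C} := by
  rintro _ ⟨r, C, rfl⟩ _ ⟨s, C', rfl⟩ ⟨D, hD, hD'⟩
  refine ⟨max r s, D, Set.Subset.antisymm ?_ ?_⟩
  · rintro B ⟨hB, hB'⟩
    rcases le_total r s with h | h
    · rw [max_eq_right h]; exact hB'.trans (Agree.symm hD')
    · rw [max_eq_left h]; exact hB.trans (Agree.symm hD)
  · have hE : Agree s D C' := hD'
    exact fun B hB =>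
      ⟨(hB.mono (le_max_left _ _)).trans hD, Agree.trans (hB.mono (le_max_right _ _)) hE⟩

/-- The class of the bridges whose labels and whole trees coincide with those of `C` at the indices
in `[-n, n]`. -/
def fullCell (n : ℕ) (C : PosTreedBridge) : Set PosTreedBridge :=
  {B | ∀ i : ℤ, |i| ≤ n → B.label i = C.label i ∧ B.tree i = C.tree i}

theorem fullCell_subset_cell (n : ℕ) (C : PosTreedBridge) : fullCell n C ⊆ cell n C :=
  fun _ hB i hi => ⟨(hB i hi).1, by rw [(hB i hi).2]⟩

theorem self_mem_fullCell (n : ℕ) (C : PosTreedBridge) : C ∈ fullCell n C :=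
  fun _ _ => ⟨rfl, rfl⟩

/-- The restriction of a bridge to the indices in `[-n, n]`. -/
def window (n : ℕ) (B : PosTreedBridge) (i : Finset.Icc (-n : ℤ) n) : ℕ × Option LTree :=
  (B.label i, B.tree i)

theorem fullCell_eq_preimage (n : ℕ) (C : PosTreedBridge) :
    fullCell n C = window n ⁻¹' {window n C} := by
  ext B
  simp [fullCell, window, funext_iff, abs_le]

theorem countable_fullCells : {s | ∃ n C, s = fullCell n C}.Countable := by
  refine (Set.countable_iUnion fun n : ℕ =>
    Set.countable_range fun d : Finset.Icc (-n : ℤ) n → ℕ × Option LTree =>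
      window n ⁻¹' {d}).mono ?_
  rintro _ ⟨n, C, rfl⟩
  exact Set.mem_iUnion.2 ⟨n, window n C, (fullCell_eq_preimage n C).symm⟩

theorem isPiSystem_fullCells : IsPiSystem {s | ∃ n C, s = fullCell n C} := by
  rintro _ ⟨r, C, rfl⟩ _ ⟨s, C', rfl⟩ ⟨D, hD, hD'⟩
  refine ⟨max r s, D, Set.Subset.antisymm ?_ ?_⟩
  · rintro B ⟨hB, hB'⟩ i hi
    rw [Nat.cast_max, le_max_iff] at hi
    rcases hi with hi | hi
    · exact ⟨(hB i hi).1.trans (hD i hi).1.symm, (hB i hi).2.trans (hD i hi).2.symm⟩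
    · exact ⟨(hB' i hi).1.trans (hD' i hi).1.symm, (hB' i hi).2.trans (hD' i hi).2.symm⟩
  · refine fun B hB => ⟨fun i hi => ?_, fun i hi => ?_⟩
    · have := hB i (hi.trans (by simp))
      exact ⟨this.1.trans (hD i hi).1, this.2.trans (hD i hi).2⟩
    · have := hB i (hi.trans (by simp))
      exact ⟨this.1.trans (hD' i hi).1, this.2.trans (hD' i hi).2⟩

instance : SecondCountableTopology PosTreedBridge := by
  have hb : TopologicalSpace.IsTopologicalBasis {s | ∃ r C, s = cell r C} := by
    refine TopologicalSpace.isTopologicalBasis_of_isOpen_of_nhds ?_ fun B G hB hG => ?_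
    · rintro _ ⟨r, C, rfl⟩
      exact isOpen_cell r C
    · obtain ⟨r, hr⟩ := isOpen_iff_agree.1 hG B hB
      exact ⟨_, ⟨r, B, rfl⟩, agree_refl r B, hr⟩
  refine hb.secondCountableTopology ((Set.countable_iUnion fun n : ℕ =>
    Set.countable_range fun d : Finset.Icc (-n : ℤ) n → ℕ × Option LTree =>
      {B | (fun i => ((window n B i).1, (window n B i).2.map (LTree.trunc n))) = d}).mono ?_)
  rintro _ ⟨n, C, rfl⟩
  refine Set.mem_iUnion.2 ⟨n, fun i => ((window n C i).1, (window n C i).2.map (LTree.trunc n)), ?_⟩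
  ext B
  simp [cell, window, funext_iff, abs_le, Agree]

theorem measurable_label (i : ℤ) : Measurable fun B : PosTreedBridge => B.label i := by
  refine measurable_to_countable' fun n => (isOpen_iff_agree.2 fun B hB => ?_).measurableSet
  refine ⟨i.natAbs, fun B' hB' => ?_⟩
  exact (hB' i (by simp)).1.trans hB

/-- A tree is determined by its truncations, and each truncation is read from a cell of large enough
level. -/
theorem measurableSet_tree (i : ℤ) (o : Option LTree) :
    MeasurableSet {B : PosTreedBridge | B.tree i = o} := by
  have key : {B : PosTreedBridge | B.tree i = o} =
      ⋂ r, {B | (B.tree i).map (LTree.trunc r) = o.map (LTree.trunc r)} := by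
    ext B
    simp only [Set.mem_ofPred_eq, Set.mem_iInter]
    refine ⟨fun h r => by rw [h], fun h => ?_⟩
    cases hB : B.tree i with
    | none =>
      cases o with
      | none => rfl
      | some t => simpa [hB] using h 0
    | some s =>
      cases o with
      | none => simpa [hB] using h 0
      | some t => exact congrArg some (LTree.eq_of_forall_trunc_eq fun r => by
          simpa [hB] using h r)
  rw [key]
  refine MeasurableSet.iInter fun r => (isOpen_iff_agree.2 fun B hB => ?_).measurableSet
  refine ⟨max r i.natAbs, fun B' hB' => ?_⟩
  have h1 := (hB' i (by simp)).2
  have h2 := congrArg (Option.map (LTree.trunc r)) h1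
  have h4 : LTree.trunc r ∘ LTree.trunc (max r i.natAbs) = LTree.trunc r :=
    funext fun t => LTree.trunc_trunc t r _ (le_max_left _ _)
  rw [Option.map_map, Option.map_map, h4] at h2
  exact h2.trans hB

theorem measurableSet_fullCell (n : ℕ) (C : PosTreedBridge) : MeasurableSet (fullCell n C) := by
  have : fullCell n C = ⋂ i : ℤ, ⋂ _ : |i| ≤ n,
      ({B | B.label i = C.label i} ∩ {B | B.tree i = C.tree i}) := by
    ext B
    simp [fullCell]
  rw [this]
  exact MeasurableSet.iInter fun i => MeasurableSet.iInter fun _ =>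
    (measurable_label i (measurableSet_singleton _)).inter (measurableSet_tree i _)

/-- Every open set is a countable union of full cells. These fix whole trees, which is the form in
which `IsLawOfBInfinity.trees` gives probabilities. -/
theorem borel_eq_generateFrom :
    borel PosTreedBridge =
      MeasurableSpace.generateFrom {s | ∃ n C, s = fullCell n C} := by
  refine le_antisymm ?_ (MeasurableSpace.generateFrom_le ?_)
  · refine MeasurableSpace.generateFrom_le fun G (hG : IsOpen G) => ?_
    have : G = ⋃₀ {s | (∃ n C, s = fullCell n C) ∧ s ⊆ G} := by
      refine Set.Subset.antisymm (fun B hB => ?_) (Set.sUnion_subset fun s hs => hs.2)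
      obtain ⟨r, hr⟩ := isOpen_iff_agree.1 hG B hB
      exact ⟨fullCell r B, ⟨⟨r, B, rfl⟩, (fullCell_subset_cell r B).trans hr⟩,
        self_mem_fullCell r B⟩
    rw [this]
    exact MeasurableSet.sUnion (countable_fullCells.mono fun s hs => hs.1)
      fun s hs => MeasurableSpace.measurableSet_generateFrom hs.1
  · rintro _ ⟨n, C, rfl⟩
    exact measurableSet_fullCell n C

theorem measurable_of_coords {Ω : Type*} [MeasurableSpace Ω] {f : Ω → PosTreedBridge}
    (hl : ∀ i, Measurable fun ω => (f ω).label i)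
    (ht : ∀ i o, MeasurableSet {ω | (f ω).tree i = o}) : Measurable f := by
  change @Measurable _ _ _ (borel _) f
  rw [borel_eq_generateFrom]
  refine measurable_generateFrom ?_
  rintro _ ⟨n, C, rfl⟩
  have : f ⁻¹' fullCell n C = ⋂ i : ℤ, ⋂ _ : |i| ≤ n,
      ((fun ω => (f ω).label i) ⁻¹' {C.label i} ∩ {ω | (f ω).tree i = C.tree i}) := by
    ext B
    simp [fullCell]
  rw [this]
  exact MeasurableSet.iInter fun i => MeasurableSet.iInter fun _ =>
    (hl i (measurableSet_singleton _)).inter (ht i _)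

theorem measurable_label_fun {P : ℕ∞} : Measurable fun B : OfHalfLength P => B.1.label :=
  measurable_pi_lambda _ fun i => (measurable_label i).comp measurable_subtype_coe

instance {P : ℕ∞} : MeasurableSingletonClass (OfHalfLength P) where
  measurableSet_singleton C := by
    have : {C} = ⋂ n, (Subtype.val ⁻¹' fullCell n C.1 : Set (OfHalfLength P)) := by
      ext B
      simp only [Set.mem_singleton_iff, Set.mem_iInter, Set.mem_preimage]
      refine ⟨fun h n => h ▸ self_mem_fullCell n _, fun h => ?_⟩
      have h' : ∀ i, B.1.label i = C.1.label i ∧ B.1.tree i = C.1.tree i :=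
        fun i => h i.natAbs i (by simp)
      exact Subtype.ext (PosTreedBridge.ext (B.2.trans C.2.symm) (funext fun i => (h' i).1)
        (funext fun i => (h' i).2))
    rw [this]
    exact MeasurableSet.iInter fun n => measurable_subtype_coe (measurableSet_fullCell n _)

theorem ext_of_finite {p : ℕ} (hp : 0 < p) {B C : OfHalfLength p}
    (h : ∀ i : ℕ, i < 2 * p → B.1.label i = C.1.label i ∧ B.1.tree i = C.1.tree i) : B = C := by
  have hper : ∀ f : ℤ → ℕ × Option LTree, (∀ i, f (i + 2 * p) = f i) →
      ∀ i, f i = f ((i % (2 * p : ℤ)).toNat : ℤ) := by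
    intro f hf i
    have hf' : Function.Periodic f (2 * p : ℤ) := hf
    rw [Int.toNat_of_nonneg (Int.emod_nonneg _ (by omega))]
    conv_lhs => rw [← Int.emod_add_mul_ediv i (2 * p : ℤ), mul_comm (2 * p : ℤ) (i / _)]
    exact hf'.int_mul _ _
  have hB := hper (fun i => (B.1.label i, B.1.tree i)) fun i => by
    simp [B.1.label_periodic p B.2 i, B.1.tree_periodic p B.2 i]
  have hC := hper (fun i => (C.1.label i, C.1.tree i)) fun i => by
    simp [C.1.label_periodic p C.2 i, C.1.tree_periodic p C.2 i]
  have key : ∀ i, B.1.label i = C.1.label i ∧ B.1.tree i = C.1.tree i := by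
    intro i
    have h1 := h (i % (2 * p : ℤ)).toNat (by
      have := Int.emod_lt_of_pos i (show (0 : ℤ) < 2 * p by omega)
      omega)
    have h2 := hB i
    have h3 := hC i
    simp only [Prod.mk.injEq] at h2 h3
    exact ⟨h2.1.trans (h1.1.trans h3.1.symm), h2.2.trans (h1.2.trans h3.2.symm)⟩
  exact Subtype.ext (PosTreedBridge.ext (B.2.trans C.2.symm) (funext fun i => (key i).1)
    (funext fun i => (key i).2))

theorem countable_ofHalfLength {p : ℕ} (hp : 0 < p) : Countable (OfHalfLength p) := by
  refine Function.Injective.countable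
    (f := fun (B : OfHalfLength p) (i : Fin (2 * p)) => (B.1.label i, B.1.tree i)) ?_
  intro B C h
  refine ext_of_finite hp fun i hi => ?_
  simpa using congrFun h ⟨i, hi⟩

/-- The sequences of labels which coincide with `c` at the indices in `[m, n]`. -/
def cylinderSet (m n : ℤ) (c : ℤ → ℕ) : Set (ℤ → ℕ) := {x | ∀ i, m ≤ i → i ≤ n → x i = c i}

theorem measurableSet_cylinderSet (m n : ℤ) (c : ℤ → ℕ) : MeasurableSet (cylinderSet m n c) := by
  have : cylinderSet m n c = ⋂ i : ℤ, ⋂ _ : m ≤ i, ⋂ _ : i ≤ n, (fun x => x i) ⁻¹' {c i} := by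
    ext x
    simp [cylinderSet]
  rw [this]
  exact MeasurableSet.iInter fun i => MeasurableSet.iInter fun _ => MeasurableSet.iInter fun _ =>
    measurable_pi_apply i (measurableSet_singleton _)

/-- The down-steps of a bridge at the indices in `[-n, n]`. -/
noncomputable def downSteps (n : ℕ) (C : PosTreedBridge) : Finset ℤ :=
  (Finset.Icc (-n : ℤ) n).filter fun i => C.label (i + 1) < C.label i

theorem mem_downSteps {n : ℕ} {C : PosTreedBridge} {i : ℤ} :
    i ∈ downSteps n C ↔ (-n ≤ i ∧ i ≤ n) ∧ C.label (i + 1) < C.label i := by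
  simp [downSteps]

/-- The tree at a down-step, with a junk value elsewhere. -/
def treeD (C : PosTreedBridge) (i : ℤ) : LTree := (C.tree i).getD (.node 0 [])

theorem tree_eq_some_treeD (C : PosTreedBridge) {i : ℤ} (h : C.label (i + 1) < C.label i) :
    C.tree i = some (C.treeD i) := by
  obtain ⟨t, -, ht⟩ := C.tree_of_down i h
  simp [treeD, ht]

theorem eq_of_down_iff {a b c d : ℕ} (h1 : b = a + 1 ∨ a = b + 1) (h2 : d = c + 1 ∨ c = d + 1)
    (hac : a = c) (h : b < a ↔ d < c) : b = d := by omega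

theorem down_iff_of_map_eq {f g : LTree → LTree} {B C : PosTreedBridge} {i : ℤ}
    (h : (B.tree i).map f = (C.tree i).map g) :
    B.label (i + 1) < B.label i ↔ C.label (i + 1) < C.label i := by
  by_cases hB : B.label (i + 1) < B.label i <;> by_cases hC : C.label (i + 1) < C.label i
  · simp [hB, hC]
  · rw [B.tree_eq_some_treeD hB, C.tree_of_not_down i hC] at h
    simp at h
  · rw [C.tree_eq_some_treeD hC, B.tree_of_not_down i hB] at h
    simp at h
  · simp [hB, hC]

/-- Separates the condition on the labels from that on the trees at the down-steps. The window of
labels extends to `n + 1` in order to include the end of the step at `n`. -/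
theorem mem_fullCell_iff {n : ℕ} {B C : PosTreedBridge} : B ∈ fullCell n C ↔
    B.label ∈ cylinderSet (-n) (n + 1) C.label ∧
      ∀ j ∈ downSteps n C, B.tree j = some (C.treeD j) := by
  constructor
  · intro h
    refine ⟨fun i hi hi' => ?_, fun j hj => ?_⟩
    · rcases hi'.lt_or_eq with hlt | rfl
      · exact (h i (abs_le.2 ⟨hi, by omega⟩)).1
      · have hn := h n (by simp)
        refine eq_of_down_iff (B.label_step n) (C.label_step n) hn.1
          (down_iff_of_map_eq (f := id) (g := id) ?_)
        rw [hn.2]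
    · rw [mem_downSteps] at hj
      rw [(h j (abs_le.2 hj.1)).2, C.tree_eq_some_treeD hj.2]
  · rintro ⟨h1, h2⟩ i hi
    rw [abs_le] at hi
    have e1 := h1 i hi.1 (by omega)
    have e2 := h1 (i + 1) (by omega) (by omega)
    refine ⟨e1, ?_⟩
    by_cases hd : C.label (i + 1) < C.label i
    · rw [h2 i (mem_downSteps.2 ⟨hi, hd⟩), C.tree_eq_some_treeD hd]
    · rw [C.tree_of_not_down i hd, B.tree_of_not_down i (by rwa [e1, e2])]

theorem mem_cell_iff {n : ℕ} {B C : PosTreedBridge} : B ∈ cell n C ↔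
    B.label ∈ cylinderSet (-n) (n + 1) C.label ∧
      ∀ j ∈ downSteps n C, (B.tree j).map (LTree.trunc n) = some ((C.treeD j).trunc n) := by
  constructor
  · intro h
    refine ⟨fun i hi hi' => ?_, fun j hj => ?_⟩
    · rcases hi'.lt_or_eq with hlt | rfl
      · exact (h i (abs_le.2 ⟨hi, by omega⟩)).1
      · have hn := h n (by simp)
        exact eq_of_down_iff (B.label_step n) (C.label_step n) hn.1 (down_iff_of_map_eq hn.2)
    · rw [mem_downSteps] at hj
      rw [(h j (abs_le.2 hj.1)).2, C.tree_eq_some_treeD hj.2, Option.map_some]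
  · rintro ⟨h1, h2⟩ i hi
    rw [abs_le] at hi
    have e1 := h1 i hi.1 (by omega)
    have e2 := h1 (i + 1) (by omega) (by omega)
    refine ⟨e1, ?_⟩
    by_cases hd : C.label (i + 1) < C.label i
    · rw [h2 i (mem_downSteps.2 ⟨hi, hd⟩), C.tree_eq_some_treeD hd, Option.map_some]
    · rw [C.tree_of_not_down i hd, B.tree_of_not_down i (by rwa [e1, e2])]

end PosTreedBridge

open PosTreedBridge

/-! ### Uniqueness of the law of `B_∞`. -/

theorem IsPWalk.measure_eq {Ω : Type*} [MeasurableSpace Ω] {μ : Measure Ω} [IsFiniteMeasure μ]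
    {Y : ℕ → Ω → ℕ} (h : IsPWalk μ Y) (n : ℕ) (l : ℕ → ℕ) :
    μ {ω | ∀ k ≤ n, Y k ω = l k} = ENNReal.ofReal
      (if l 0 = 0 then ∏ k ∈ Finset.range n, transProb (l k) (l (k + 1)) else 0) := by
  rw [← h.2, ofReal_measureReal]

theorem measurableSet_forall_le_eq (n : ℕ) (l : ℕ → ℕ) :
    MeasurableSet {x : ℕ → ℕ | ∀ k ≤ n, x k = l k} := by
  have : {x : ℕ → ℕ | ∀ k ≤ n, x k = l k} = ⋂ k, ⋂ _ : k ≤ n, (fun x => x k) ⁻¹' {l k} := by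
    ext x
    simp
  rw [this]
  exact MeasurableSet.iInter fun k => MeasurableSet.iInter fun _ =>
    measurable_pi_apply k (measurableSet_singleton _)

theorem mem_cylinderSet_neg_iff {a b : ℕ} {x c : ℤ → ℕ} : x ∈ cylinderSet (-a) b c ↔
    (∀ k ≤ b, x (k : ℤ) = c k) ∧ ∀ k ≤ a, x (-(k : ℤ)) = c (-(k : ℤ)) := by
  constructor
  · exact fun h => ⟨fun k hk => h _ (by omega) (by omega), fun k hk => h _ (by omega) (by omega)⟩
  · rintro ⟨h1, h2⟩ i hi hi'
    rcases le_total 0 i with h0 | h0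
    · obtain ⟨k, rfl⟩ := Int.eq_ofNat_of_zero_le h0
      exact h1 k (by omega)
    · obtain ⟨k, hk⟩ := Int.eq_ofNat_of_zero_le (Int.neg_nonneg_of_nonpos h0)
      obtain rfl : i = -(k : ℤ) := by omega
      exact h2 k (by omega)

/-- Two independent `𝐩`-walks: the probability of a cylinder. -/
theorem measure_cylinder_of_walks {Ω : Type*} [MeasurableSpace Ω] {μ : Measure Ω}
    [IsFiniteMeasure μ] {x : Ω → ℤ → ℕ}
    (hr : IsPWalk μ fun i ω => x ω (i : ℤ)) (hl : IsPWalk μ fun i ω => x ω (-(i : ℤ)))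
    (hi : IndepFun (fun ω (i : ℕ) => x ω (i : ℤ)) (fun ω (i : ℕ) => x ω (-(i : ℤ))) μ)
    (a b : ℕ) (c : ℤ → ℕ) (hc : c 0 = 0) :
    μ {ω | x ω ∈ cylinderSet (-a) b c} = ENNReal.ofReal
      ((∏ k ∈ Finset.range b, transProb (c k) (c (k + 1))) *
        ∏ k ∈ Finset.range a, transProb (c (-k)) (c (-(k + 1)))) := by
  have h := hi.measure_inter_preimage_eq_mul _ _
    (measurableSet_forall_le_eq b fun k => c k) (measurableSet_forall_le_eq a fun k => c (-k))
  have h1 := hr.measure_eq b fun k => c k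
  have h2 := hl.measure_eq a fun k => c (-k)
  simp only [Nat.cast_zero, neg_zero, hc, if_true, Nat.cast_add, Nat.cast_one] at h1 h2
  rw [ENNReal.ofReal_mul (Finset.prod_nonneg fun _ _ => transProb_nonneg _ _), ← h1, ← h2]
  refine Eq.trans ?_ h
  congr 1
  ext ω
  exact mem_cylinderSet_neg_iff

theorem IsLawOfBInfinity.measure_fullCell {ν : Measure (OfHalfLength ⊤)} [IsFiniteMeasure ν]
    (h : IsLawOfBInfinity ν) (n : ℕ) (C : PosTreedBridge) :
    ν (Subtype.val ⁻¹' fullCell n C) =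
      (∏ j ∈ downSteps n C, LTree.rhoPlus (C.label j) (C.treeD j)) * ENNReal.ofReal
      ((∏ k ∈ Finset.range (n + 1), transProb (C.label k) (C.label (k + 1))) *
        ∏ k ∈ Finset.range n, transProb (C.label (-k)) (C.label (-(k + 1)))) := by
  have hm := measurableSet_cylinderSet (-n) (n + 1) C.label
  have h1 := h.trees (downSteps n C) (cylinderSet (-n) (n + 1) C.label) hm
    (fun x hx j hj => by
      rw [mem_downSteps] at hj
      rw [hx j hj.1.1 (by omega), hx (j + 1) (by omega) (by omega)]
      exact hj.2) C.treeD
  have h2 := measure_cylinder_of_walks h.right_walk h.left_walk h.indep n (n + 1) C.label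
    C.label_zero
  rw [← h2]
  calc ν (Subtype.val ⁻¹' fullCell n C) = _ := by
        congr 1
        ext B
        exact mem_fullCell_iff
    _ = _ := h1
    _ = ∫⁻ B in {B | B.1.label ∈ cylinderSet (-n) (n + 1) C.label},
          ∏ j ∈ downSteps n C, LTree.rhoPlus (C.label j) (C.treeD j) ∂ν := by
        -- On the cylinder the labels are those of `C`, so the integrand is constant.
        refine setLIntegral_congr_fun (measurable_label_fun hm) fun B hB => ?_
        refine Finset.prod_congr rfl fun j hj => ?_
        rw [mem_downSteps] at hj
        rw [hB j hj.1.1 (by omega)]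
    _ = _ := by
        rw [setLIntegral_const]
        norm_cast

/-- The defining properties fix the mass of every full cell, and the full cells are a π-system that
generates the Borel sets. -/
theorem IsLawOfBInfinity.unique {ν ν' : Measure (OfHalfLength ⊤)} [IsProbabilityMeasure ν]
    [IsProbabilityMeasure ν'] (h : IsLawOfBInfinity ν) (h' : IsLawOfBInfinity ν') : ν = ν' := by
  refine ext_of_generate_finite
    (Set.preimage (Subtype.val : OfHalfLength ⊤ → PosTreedBridge) '' {s | ∃ n C, s = fullCell n C})
    ?_ (isPiSystem_fullCells.comap _) ?_ (by simp)
  · rw [← MeasurableSpace.comap_generateFrom, ← borel_eq_generateFrom]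
    rfl
  · rintro _ ⟨_, ⟨n, C, rfl⟩, rfl⟩
    rw [h.measure_fullCell, h'.measure_fullCell]

/-! ### The field of independent Boltzmann trees. -/

namespace LTree

instance : MeasurableSpace LTree := ⊤

instance : DiscreteMeasurableSpace LTree := ⟨fun _ => trivial⟩

/-- The Boltzmann probability measure on `LT_k^+`. -/
noncomputable def rhoMeasure (k : ℕ) : Measure (PositiveWithRoot k) :=
  Measure.sum fun s => (s.1.weight / totalWeight k) • Measure.dirac s

theorem totalWeight_succ_ne_zero (k : ℕ) : totalWeight (k + 1) ≠ 0 := by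
  rw [totalWeight_eq]
  exact (ENNReal.ofReal_pos.2 (weightFormula_pos k)).ne'

instance (k : ℕ) : IsProbabilityMeasure (rhoMeasure (k + 1)) := by
  refine HasSum.isProbabilityMeasure_sum_dirac_ennreal ?_
  have : ∑' s : PositiveWithRoot (k + 1), s.1.weight / totalWeight (k + 1) = 1 := by
    simp only [div_eq_mul_inv]
    rw [ENNReal.tsum_mul_right]
    exact ENNReal.mul_inv_cancel (totalWeight_succ_ne_zero k) (totalWeight_ne_top _)
  exact this ▸ ENNReal.summable.hasSum

theorem rhoMeasure_eq (k : ℕ) (t : LTree) :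
    rhoMeasure k {s | s.1 = t} = rhoPlus k t := by
  unfold rhoPlus
  split_ifs with h
  · have : {s : PositiveWithRoot k | s.1 = t} = {⟨t, h⟩} := by
      ext s
      simp [Subtype.ext_iff]
    rw [this, rhoMeasure, Measure.sum_smul_dirac_singleton, totalWeight]
  · have : {s : PositiveWithRoot k | s.1 = t} = ∅ := by
      ext s
      simp only [Set.mem_ofPred_eq, Set.mem_empty_iff_false, iff_false]
      exact fun hs => h (hs ▸ s.2)
    rw [this, measure_empty]

end LTree

/-- A positive tree with root label `k + 1` for each index and each `k`. -/
abbrev TreeField : Type := ∀ a : ℤ × ℕ, LTree.PositiveWithRoot (a.2 + 1)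

/-- The law of a family of independent Boltzmann trees. -/
noncomputable def treeFieldLaw : Measure TreeField :=
  Measure.infinitePi fun a => LTree.rhoMeasure (a.2 + 1)

instance : IsProbabilityMeasure treeFieldLaw := by
  unfold treeFieldLaw
  infer_instance

/-- Injectivity of `g` makes the coordinates `(g j, c j)` distinct, hence independent. The shift `c
j + 1` is the root label: a tree is indexed by the label reached after its down-step. -/
theorem treeFieldLaw_box (J : Finset ℤ) (g : ℤ → ℤ) (hg : Set.InjOn g J) (c : ℤ → ℕ)
    (s : ℤ → LTree) :
    treeFieldLaw {τ | ∀ j ∈ J, (τ (g j, c j)).1 = s j} =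
      ∏ j ∈ J, LTree.rhoPlus (c j + 1) (s j) := by
  classical
  have hinj : Set.InjOn (fun j => (g j, c j)) J := fun j hj j' hj' h => hg hj hj' (Prod.ext_iff.1 h).1
  have hinv : ∀ j ∈ J, Function.invFunOn g J (g j) = j := fun j hj => hg.leftInvOn_invFunOn hj
  have hset : {τ : TreeField | ∀ j ∈ J, (τ (g j, c j)).1 = s j} =
      Set.pi (J.image fun j => (g j, c j) : Finset (ℤ × ℕ))
        fun a : ℤ × ℕ => {t : LTree.PositiveWithRoot (a.2 + 1) | t.1 = s (Function.invFunOn g J a.1)} := by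
    ext τ
    simp only [Set.mem_ofPred_eq, Set.mem_pi, Finset.coe_image, Set.forall_mem_image,
      Finset.mem_coe]
    exact forall₂_congr fun j hj => by rw [hinv j hj]
  rw [hset, treeFieldLaw, Measure.infinitePi_pi _ fun a _ => MeasurableSet.of_discrete,
    Finset.prod_image hinj]
  refine Finset.prod_congr rfl fun j hj => ?_
  rw [LTree.rhoMeasure_eq, hinv j hj]

/-! ### Bridges built from a path and a field of trees. -/

namespace PosTreedBridge

/-- The sequences of labels of the positive treed bridges of length `2 P`. -/
abbrev Path (P : ℕ∞) : Type :=
  {x : ℤ → ℕ // x 0 = 0 ∧ (∀ i, x (i + 1) = x i + 1 ∨ x i = x (i + 1) + 1) ∧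
    ∀ p : ℕ, P = p → ∀ i, x (i + 2 * p) = x i}

theorem measurable_path_val {P : ℕ∞} : Measurable fun x : Path P => x.1 := measurable_subtype_coe

theorem measurable_path_apply {P : ℕ∞} (i : ℤ) : Measurable fun x : Path P => x.1 i :=
  (measurable_pi_apply i).comp measurable_path_val

/-- The representative in `[-p, p)` of an index modulo `2 p`; the index itself if `p = ∞`. -/
def fold (P : ℕ∞) (i : ℤ) : ℤ := i.bmod (2 * P.toNat)

theorem fold_top (i : ℤ) : fold ⊤ i = i := by simp [fold]

theorem fold_add (p : ℕ) (i : ℤ) : fold p (i + 2 * p) = fold p i := by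
  have := Int.add_bmod_right i (2 * p)
  simpa [fold] using this

theorem fold_of_lt {p : ℕ} {i : ℤ} (h : -p ≤ i) (h' : i < p) : fold p i = i := by
  rw [fold, ENat.toNat_natCast]
  exact Int.bmod_eq_of_le_mul_two (by push_cast; omega) (by push_cast; omega)

theorem fold_injOn {p : ℕ} : Set.InjOn (fold p) (Set.Ico 0 (2 * p : ℤ)) := by
  intro i hi j hj h
  rw [fold, fold, ENat.toNat_natCast] at h
  have h1 := congrArg (fun x : ℤ => x % ((2 * p : ℕ) : ℤ)) h
  simp only [Int.bmod_emod] at h1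
  rw [Set.mem_Ico] at hi hj
  rwa [Int.emod_eq_of_lt hi.1 (by push_cast; omega),
    Int.emod_eq_of_lt hj.1 (by push_cast; omega)] at h1

/-- The bridge with a given sequence of labels, whose trees are read in a field of trees. -/
def treed {P : ℕ∞} (hP : P ≠ 0) (ω : Path P × TreeField) : OfHalfLength P :=
  ⟨{ halfLength := P
     halfLength_ne_zero := hP
     label := ω.1.1
     tree := fun i => if ω.1.1 (i + 1) < ω.1.1 i then some (ω.2 (fold P i, ω.1.1 (i + 1))).1
       else none
     label_zero := ω.1.2.1
     label_step := ω.1.2.2.1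
     label_periodic := ω.1.2.2.2
     tree_of_down := fun i hi => by
       have h : ω.1.1 i = ω.1.1 (i + 1) + 1 := by
         have := ω.1.2.2.1 i
         omega
       rw [h, if_pos (by omega)]
       exact ⟨_, (ω.2 _).2, rfl⟩
     tree_of_not_down := fun i hi => if_neg hi
     tree_periodic := fun p hp i => by
       have h1 := ω.1.2.2.2 p hp i
       have h2 := ω.1.2.2.2 p hp (i + 1)
       rw [show i + 1 + 2 * (p : ℤ) = i + 2 * p + 1 by ring] at h2
       subst hp
       rw [h1, h2, fold_add] }, rfl⟩

theorem treed_label {P : ℕ∞} (hP : P ≠ 0) (ω : Path P × TreeField) :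
    (treed hP ω).1.label = ω.1.1 := rfl

theorem treed_tree {P : ℕ∞} (hP : P ≠ 0) (ω : Path P × TreeField) (i : ℤ) :
    (treed hP ω).1.tree i =
      if ω.1.1 (i + 1) < ω.1.1 i then some (ω.2 (fold P i, ω.1.1 (i + 1))).1 else none := rfl

theorem measurable_treed {P : ℕ∞} (hP : P ≠ 0) : Measurable (treed hP) := by
  refine Measurable.subtype_mk (measurable_of_coords (f := fun ω => (treed hP ω).1)
    (fun i => (measurable_path_apply i).comp measurable_fst) fun i o => ?_)
  have hm : ∀ j, Measurable fun ω : Path P × TreeField => ω.1.1 j :=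
    fun j => (measurable_path_apply j).comp measurable_fst
  have hdown : MeasurableSet {ω : Path P × TreeField | ω.1.1 (i + 1) < ω.1.1 i} :=
    measurableSet_lt (hm _) (hm _)
  cases o with
  | none =>
    convert hdown.compl using 1
    ext ω
    simp [treed_tree]
  | some t =>
    have : {ω : Path P × TreeField | (treed hP ω).1.tree i = some t} =
        {ω | ω.1.1 (i + 1) < ω.1.1 i} ∩
          ⋃ k, ({ω | ω.1.1 (i + 1) = k} ∩ {ω | (ω.2 (fold P i, k)).1 = t}) := by
      ext ω
      simp [treed_tree]
    rw [this]
    refine hdown.inter (MeasurableSet.iUnion fun k =>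
      (hm _ (measurableSet_singleton k)).inter ?_)
    have h1 : Measurable fun ω : Path P × TreeField => (ω.2 (fold P i, k)).1 :=
      measurable_subtype_coe.comp ((measurable_pi_apply _).comp measurable_snd)
    exact h1 (measurableSet_singleton t)

/-- The law of the bridge whose labels have law `π` and whose trees are, given the labels,
independent Boltzmann trees. -/
noncomputable def bridgeLaw {P : ℕ∞} (hP : P ≠ 0) (π : Measure (Path P)) :
    Measure (OfHalfLength P) := (π.prod treeFieldLaw).map (treed hP)

instance {P : ℕ∞} (hP : P ≠ 0) (π : Measure (Path P)) [IsProbabilityMeasure π] :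
    IsProbabilityMeasure (bridgeLaw hP π) :=
  Measure.isProbabilityMeasure_map (measurable_treed hP).aemeasurable

/-- For `n < p` the centred representative of an index in `[-n, n]` is the index itself. The factor
from the trees is thus the same for all such lengths, infinite length included, and only the law of
the labels varies. -/
theorem bridgeLaw_cell {P : ℕ∞} (hP : P ≠ 0) (π : Measure (Path P)) [IsProbabilityMeasure π]
    (n : ℕ) (hn : ∀ p : ℕ, P = p → n < p) (C : PosTreedBridge) :
    bridgeLaw hP π (Subtype.val ⁻¹' cell n C) =
      π {x | x.1 ∈ cylinderSet (-n) (n + 1) C.label} *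
        treeFieldLaw {τ | ∀ j ∈ downSteps n C,
          (τ (j, C.label (j + 1))).1.trunc n = (C.treeD j).trunc n} := by
  rw [bridgeLaw, Measure.map_apply (measurable_treed hP)
    (measurable_subtype_coe (isOpen_cell n C).measurableSet), ← Measure.prod_prod]
  congr 1
  ext ω
  simp only [Set.mem_preimage, mem_cell_iff, treed_label, Set.mem_prod, Set.mem_ofPred_eq]
  refine and_congr_right fun h => forall₂_congr fun j hj => ?_
  rw [mem_downSteps] at hj
  have hfold : fold P j = j := by
    induction P using ENat.recTopCoe with
    | top => exact fold_top j
    | coe p =>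
      have := hn p rfl
      exact fold_of_lt (by omega) (by omega)
  rw [treed_tree, h j hj.1.1 (by omega), h (j + 1) (by omega) (by omega), if_pos hj.2, hfold]
  simp

/-- A finite bridge is determined by one period `0, …, 2 p - 1`, on which `fold` is injective, so
the trees involved are independent. -/
theorem bridgeLaw_singleton {p : ℕ} (hp : 0 < p) (hP : (p : ℕ∞) ≠ 0) (π : Measure (Path p))
    [IsProbabilityMeasure π] (B : OfHalfLength p) :
    bridgeLaw hP π {B} = π {x | x.1 = B.1.label} *
      ∏ i ∈ Finset.range (2 * p), (B.1.tree i).elim 1 (LTree.rhoPlus (B.1.label i)) := by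
  classical
  set J : Finset ℤ := (Finset.Ico 0 (2 * p : ℤ)).filter fun i => B.1.label (i + 1) < B.1.label i
    with hJ
  have hJmem : ∀ j, j ∈ J ↔ (0 ≤ j ∧ j < 2 * p) ∧ B.1.label (j + 1) < B.1.label j := by
    simp [hJ]
  have hset : treed hP ⁻¹' {B} = {x : Path p | x.1 = B.1.label} ×ˢ
      {τ | ∀ j ∈ J, (τ (fold p j, B.1.label (j + 1))).1 = B.1.treeD j} := by
    ext ω
    simp only [Set.mem_preimage, Set.mem_singleton_iff, Set.mem_prod, Set.mem_ofPred_eq]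
    constructor
    · intro h
      have h1 : ω.1.1 = B.1.label := by rw [← h, treed_label]
      refine ⟨h1, fun j hj => ?_⟩
      have h2 := treed_tree hP ω j
      rw [hJmem] at hj
      rw [h, h1, if_pos hj.2, B.1.tree_eq_some_treeD hj.2, Option.some.injEq] at h2
      exact h2.symm
    · rintro ⟨h1, h2⟩
      refine ext_of_finite hp fun i hi => ⟨by rw [treed_label, h1], ?_⟩
      rw [treed_tree, h1]
      split_ifs with hd
      · rw [h2 i ((hJmem _).2 ⟨⟨by omega, by omega⟩, hd⟩), B.1.tree_eq_some_treeD hd]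
      · rw [B.1.tree_of_not_down _ hd]
  rw [bridgeLaw, Measure.map_apply (measurable_treed hP) (measurableSet_singleton B), hset,
    Measure.prod_prod, treeFieldLaw_box J (fold p) (fold_injOn.mono fun j hj => by
      have := (hJmem j).1 hj
      exact this.1) (fun j => B.1.label (j + 1)) B.1.treeD]
  congr 1
  have hrange : Finset.Ico 0 (2 * p : ℤ) = (Finset.range (2 * p)).map Nat.castEmbedding := by
    ext j
    simp only [Finset.mem_Ico, Finset.mem_map, Finset.mem_range, Nat.castEmbedding_apply]
    exact ⟨fun h => ⟨j.toNat, by omega, by omega⟩, by rintro ⟨a, ha, rfl⟩; omega⟩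
  rw [hJ, Finset.prod_filter, hrange, Finset.prod_map]
  refine Finset.prod_congr rfl fun i _ => ?_
  simp only [Nat.castEmbedding_apply]
  split_ifs with hd
  · rw [B.1.tree_eq_some_treeD hd]
    have : B.1.label i = B.1.label (i + 1) + 1 := by
      have := B.1.label_step i
      omega
    simp [this]
  · rw [B.1.tree_of_not_down _ hd]
    rfl

/-- By Fubini it suffices to fix the path. The event on the trees is then a box of the field, whose
mass is the product of the `rhoPlus`. -/
theorem bridgeLaw_trees (hP : (⊤ : ℕ∞) ≠ 0) (π : Measure (Path ⊤)) [IsProbabilityMeasure π]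
    (J : Finset ℤ) (A : Set (ℤ → ℕ)) (hA : MeasurableSet A)
    (hAJ : ∀ x ∈ A, ∀ j ∈ J, x (j + 1) < x j) (s : ℤ → LTree) :
    bridgeLaw hP π {B | B.1.label ∈ A ∧ ∀ j ∈ J, B.1.tree j = some (s j)} =
      ∫⁻ B in {B | B.1.label ∈ A}, ∏ j ∈ J, LTree.rhoPlus (B.1.label j) (s j)
        ∂(bridgeLaw hP π) := by
  have hlabel : MeasurableSet {B : OfHalfLength ⊤ | B.1.label ∈ A} := measurable_label_fun hA
  have hm : MeasurableSet {B : OfHalfLength ⊤ | B.1.label ∈ A ∧ ∀ j ∈ J, B.1.tree j = some (s j)} := by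
    have : {B : OfHalfLength ⊤ | B.1.label ∈ A ∧ ∀ j ∈ J, B.1.tree j = some (s j)} =
        {B | B.1.label ∈ A} ∩ ⋂ j ∈ J, Subtype.val ⁻¹' {B | B.tree j = some (s j)} := by
      ext B
      simp
    rw [this]
    exact hlabel.inter (Finset.measurableSet_biInter _ fun j _ =>
      measurable_subtype_coe (measurableSet_tree j _))
  have hf : Measurable fun x : ℤ → ℕ => ∏ j ∈ J, LTree.rhoPlus (x j) (s j) :=
    Finset.measurable_prod _ fun j _ =>
      (measurable_of_countable fun k : ℕ => LTree.rhoPlus k (s j)).comp (measurable_pi_apply j)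
  have hf2 : Measurable fun B : OfHalfLength ⊤ =>
      ∏ j ∈ J, LTree.rhoPlus (B.1.label j) (s j) := hf.comp measurable_label_fun
  have hA' : MeasurableSet {x : Path ⊤ | x.1 ∈ A} := measurable_path_val hA
  rw [bridgeLaw, setLIntegral_map hlabel hf2 (measurable_treed hP),
    Measure.map_apply (measurable_treed hP) hm,
    Measure.prod_apply (measurable_treed hP hm), ← lintegral_indicator
      (measurable_treed hP hlabel)]
  have hfst : MeasurePreserving Prod.fst (π.prod treeFieldLaw) π := measurePreserving_fst
  have hrhs : (fun ω : Path ⊤ × TreeField => (treed hP ⁻¹' {B | B.1.label ∈ A}).indicator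
      (fun ω => ∏ j ∈ J, LTree.rhoPlus ((treed hP ω).1.label j) (s j)) ω) =
      (Set.indicator {x : Path ⊤ | x.1 ∈ A} fun x => ∏ j ∈ J, LTree.rhoPlus (x.1 j) (s j)) ∘
        Prod.fst := by
    ext ω
    rfl
  rw [hrhs]
  refine Eq.trans ?_ (hfst.lintegral_comp ((hf.comp measurable_path_val).indicator hA')).symm
  refine lintegral_congr fun x => ?_
  by_cases hx : x.1 ∈ A
  · rw [Set.indicator_of_mem (show x ∈ {x : Path ⊤ | x.1 ∈ A} from hx)]
    have h1 := treeFieldLaw_box J id (Set.injOn_id _) (fun j => x.1 (j + 1)) s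
    have h2 : Prod.mk x ⁻¹' (treed hP ⁻¹' {B | B.1.label ∈ A ∧ ∀ j ∈ J, B.1.tree j = some (s j)}) =
        {τ | ∀ j ∈ J, (τ (id j, x.1 (j + 1))).1 = s j} := by
      ext τ
      simp only [Set.mem_preimage, Set.mem_ofPred_eq, treed_label, hx, true_and]
      refine forall₂_congr fun j hj => ?_
      rw [treed_tree, if_pos (hAJ _ hx j hj), fold_top]
      simp
    rw [h2, h1]
    refine Finset.prod_congr rfl fun j hj => ?_
    have h3 := hAJ _ hx j hj
    have h4 := x.2.2.1 j
    change _ = LTree.rhoPlus (x.1 j) (s j)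
    rw [show x.1 j = x.1 (j + 1) + 1 by omega]
  · rw [Set.indicator_of_notMem (show x ∉ {x : Path ⊤ | x.1 ∈ A} from hx)]
    convert measure_empty (μ := treeFieldLaw) using 2
    ext τ
    simp [treed_label, hx]

end PosTreedBridge

/-! ### Construction of the walk and its Markov property. -/

/-- The law of the direction of a step from `k`: `true` is a step up. -/
noncomputable def coinLaw (k : ℕ) : Measure Bool :=
  ENNReal.ofReal (transProb k (k + 1)) • Measure.dirac true +
    ENNReal.ofReal (transProb k (k - 1)) • Measure.dirac false

instance (k : ℕ) : IsProbabilityMeasure (coinLaw k) := by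
  constructor
  rw [coinLaw, Measure.add_apply, Measure.smul_apply, Measure.smul_apply, measure_univ,
    measure_univ, smul_eq_mul, smul_eq_mul, mul_one, mul_one,
    ← ENNReal.ofReal_add (transProb_nonneg _ _) (transProb_nonneg _ _), transProb_up_add_pred,
    ENNReal.ofReal_one]

/-- A step from `k` in a given direction; the steps from `0` are always up. -/
def stepFrom (k : ℕ) (b : Bool) : ℕ := if k = 0 ∨ b = true then k + 1 else k - 1

theorem stepFrom_adj (k : ℕ) (b : Bool) : stepFrom k b = k + 1 ∨ k = stepFrom k b + 1 := by
  unfold stepFrom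
  split_ifs with h
  · exact Or.inl rfl
  · omega

theorem coinLaw_stepFrom (k m : ℕ) : coinLaw k {b | stepFrom k b = m} =
    ENNReal.ofReal (transProb k m) := by
  rw [coinLaw, Measure.add_apply, Measure.smul_apply, Measure.smul_apply,
    Measure.dirac_apply' _ MeasurableSet.of_discrete,
    Measure.dirac_apply' _ MeasurableSet.of_discrete]
  simp only [Set.indicator, Set.mem_ofPred_eq, stepFrom, or_true, if_true, Pi.one_apply,
    smul_eq_mul, mul_ite, mul_one, mul_zero, Bool.false_eq_true, or_false]
  rcases Nat.eq_zero_or_pos k with rfl | hk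
  · simp only [transProb_zero_zero, ENNReal.ofReal_zero, Nat.zero_sub, ite_self, add_zero, zero_add]
    split_ifs with h
    · rw [h]
    · rw [transProb, if_neg (by omega), if_neg (by omega), ENNReal.ofReal_zero]
  · rw [if_neg hk.ne']
    by_cases h1 : k + 1 = m
    · subst h1
      simp [show ¬ k - 1 = k + 1 by omega]
    · by_cases h2 : k - 1 = m
      · subst h2
        simp [h1]
      · rw [if_neg h1, if_neg h2, transProb, if_neg (by omega), if_neg (by omega)]
        simp

/-- The nearest-neighbour walks on the natural numbers issued from `0`. -/
abbrev Walk : Type := {w : ℕ → ℕ // w 0 = 0 ∧ ∀ i, w (i + 1) = w i + 1 ∨ w i = w (i + 1) + 1}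

/-- The walk that takes at time `n`, if it is at `k`, the direction of the coin `(n, k)`. -/
def walkOfCoins (ξ : ℕ × ℕ → Bool) : ℕ → ℕ
  | 0 => 0
  | n + 1 => stepFrom (walkOfCoins ξ n) (ξ (n, walkOfCoins ξ n))

theorem measurable_walkOfCoins (n : ℕ) : Measurable fun ξ => walkOfCoins ξ n := by
  induction n with
  | zero => exact measurable_const
  | succ n ih =>
    refine measurable_to_countable' fun m => ?_
    have : (fun ξ => walkOfCoins ξ (n + 1)) ⁻¹' {m} =
        ⋃ k, ((fun ξ => walkOfCoins ξ n) ⁻¹' {k} ∩ {ξ | stepFrom k (ξ (n, k)) = m}) := by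
      ext ξ
      simp [walkOfCoins]
    rw [this]
    refine MeasurableSet.iUnion fun k => (ih (measurableSet_singleton k)).inter ?_
    have h : Measurable fun ξ : ℕ × ℕ → Bool => ξ (n, k) := measurable_pi_apply _
    exact h (MeasurableSet.of_discrete (s := {b | stepFrom k b = m}))

/-- `walkOfCoins` as a map to the type of walks. -/
def coinsToWalk (ξ : ℕ × ℕ → Bool) : Walk :=
  ⟨walkOfCoins ξ, rfl, fun _ => stepFrom_adj _ _⟩

theorem measurable_coinsToWalk : Measurable coinsToWalk :=
  (measurable_pi_lambda _ measurable_walkOfCoins).subtype_mk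

/-- The law of the walk with transition probabilities `𝐩` issued from `0`. -/
noncomputable def walkLaw : Measure Walk :=
  (Measure.infinitePi fun a : ℕ × ℕ => coinLaw a.2).map coinsToWalk

instance : IsProbabilityMeasure walkLaw :=
  Measure.isProbabilityMeasure_map measurable_coinsToWalk.aemeasurable

theorem measurable_walk_apply (n : ℕ) : Measurable fun w : Walk => w.1 n :=
  (measurable_pi_apply n).comp measurable_subtype_coe

theorem measurableSet_walk_prefix (n : ℕ) (l : ℕ → ℕ) :
    MeasurableSet {w : Walk | ∀ k ≤ n, w.1 k = l k} :=
  measurable_subtype_coe (measurableSet_forall_le_eq n l)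

theorem isPWalk_walkLaw : IsPWalk walkLaw fun n w => w.1 n := by
  refine ⟨measurable_walk_apply, fun n l => ?_⟩
  split_ifs with h0
  -- A prefix of the walk prescribes the outcome of one coin `(k, l k)` for each time `k < n`. These
  -- coins are distinct, so their probabilities multiply.
  · have hset : coinsToWalk ⁻¹' {w | ∀ k ≤ n, w.1 k = l k} =
        Set.pi ((Finset.range n).image fun k => (k, l k) : Finset (ℕ × ℕ))
          fun a : ℕ × ℕ => {b | stepFrom a.2 b = l (a.1 + 1)} := by
      ext ξ
      simp only [Set.mem_preimage, Set.mem_ofPred_eq, Set.mem_pi, Finset.coe_image,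
        Set.forall_mem_image, Finset.mem_coe, Finset.mem_range]
      constructor
      · intro h k hk
        have h1 := h (k + 1) (by omega)
        have h2 := h k (by omega)
        change stepFrom (walkOfCoins ξ k) (ξ (k, walkOfCoins ξ k)) = _ at h1
        change walkOfCoins ξ k = _ at h2
        rwa [h2] at h1
      · intro h k hk
        change walkOfCoins ξ k = l k
        induction k with
        | zero => exact h0.symm
        | succ k ih =>
          rw [walkOfCoins, ih (by omega)]
          exact h (by omega)
    rw [measureReal_def, walkLaw, Measure.map_apply measurable_coinsToWalk
      (measurableSet_walk_prefix n l), hset,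
      Measure.infinitePi_pi _ fun a _ => MeasurableSet.of_discrete,
      Finset.prod_image fun k _ k' _ h => (Prod.ext_iff.1 h).1, ENNReal.toReal_prod]
    refine Finset.prod_congr rfl fun k _ => ?_
    rw [coinLaw_stepFrom, ENNReal.toReal_ofReal (transProb_nonneg _ _)]
  · convert measureReal_empty (μ := walkLaw) using 2
    ext w
    simp only [Set.mem_ofPred_eq, Set.mem_empty_iff_false, iff_false]
    exact fun h => h0 ((h 0 (by omega)).symm.trans w.2.1)

/-- The Markov property: the probability of a beginning and of a later stretch of the walk. -/
theorem walkLaw_joint (s m n : ℕ) (l l' : ℕ → ℕ) (h0 : l 0 = 0) :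
    walkLaw.real {w | (∀ k ≤ n, w.1 k = l k) ∧ ∀ k ≤ s, w.1 (n + m + k) = l' k} =
      (∏ k ∈ Finset.range n, transProb (l k) (l (k + 1))) * walkProb m (l n) (l' 0) *
        ∏ k ∈ Finset.range s, transProb (l' k) (l' (k + 1)) := by
  induction m generalizing n l with
  | zero =>
    by_cases hn : l n = l' 0
    · have hpre := isPWalk_walkLaw.2 (n + s) fun k => if k ≤ n then l k else l' (k - n)
      rw [if_pos (by simpa using h0), Finset.prod_range_add] at hpre
      have hset : {w : Walk | (∀ k ≤ n, w.1 k = l k) ∧ ∀ k ≤ s, w.1 (n + 0 + k) = l' k} =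
          {w | ∀ k ≤ n + s, w.1 k = if k ≤ n then l k else l' (k - n)} := by
        ext w
        simp only [Set.mem_ofPred_eq]
        constructor
        · rintro ⟨h1, h2⟩ k hk
          split_ifs with hkn
          · exact h1 k hkn
          · have := h2 (k - n) (by omega)
            rwa [show n + 0 + (k - n) = k by omega] at this
        · refine fun h => ⟨fun k hk => ?_, fun k hk => ?_⟩
          · rw [h k (by omega), if_pos hk]
          · rw [add_zero, h (n + k) (by omega)]
            split_ifs with hkn
            · obtain rfl : k = 0 := by omega
              exact hn
            · rw [Nat.add_sub_cancel_left]
      rw [hset, hpre, walkProb, if_pos hn, mul_one]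
      congr 1
      · refine Finset.prod_congr rfl fun k hk => ?_
        rw [Finset.mem_range] at hk
        rw [if_pos hk.le, if_pos (by omega)]
      · refine Finset.prod_congr rfl fun k hk => ?_
        rw [if_neg (show ¬ n + k + 1 ≤ n by omega), show n + k + 1 - n = k + 1 by omega]
        congr 1
        split_ifs with hkn
        · obtain rfl : k = 0 := by omega
          exact hn
        · rw [Nat.add_sub_cancel_left]
    · rw [walkProb, if_neg hn, mul_zero, zero_mul]
      convert measureReal_empty (μ := walkLaw) using 2
      ext w
      simp only [Set.mem_ofPred_eq, Set.mem_empty_iff_false, iff_false]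
      rintro ⟨h1, h2⟩
      exact hn ((h1 n le_rfl).symm.trans (h2 0 (by omega)))
  | succ m ih =>
    -- The first step of the gap is fixed and appended to the beginning, which shortens the gap by
    -- one.
    have hstep : ∀ a : ℕ, walkLaw.real {w | (∀ k ≤ n, w.1 k = l k) ∧ w.1 (n + 1) = a ∧
        ∀ k ≤ s, w.1 (n + (m + 1) + k) = l' k} =
        (∏ k ∈ Finset.range n, transProb (l k) (l (k + 1))) * (transProb (l n) a *
          walkProb m a (l' 0)) * ∏ k ∈ Finset.range s, transProb (l' k) (l' (k + 1)) := by
      intro a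
      have h := ih (n + 1) (Function.update l (n + 1) a) (by simpa using h0)
      rw [Finset.prod_range_succ, Function.update_self,
        Function.update_of_ne (show n ≠ n + 1 by omega)] at h
      have hprod : ∏ k ∈ Finset.range n, transProb (Function.update l (n + 1) a k)
          (Function.update l (n + 1) a (k + 1)) =
          ∏ k ∈ Finset.range n, transProb (l k) (l (k + 1)) :=
        Finset.prod_congr rfl fun k hk => by
          rw [Finset.mem_range] at hk
          rw [Function.update_of_ne (by omega), Function.update_of_ne (by omega)]
      rw [hprod] at h
      rw [← mul_assoc (∏ k ∈ Finset.range n, transProb (l k) (l (k + 1))), ← h]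
      congr 1
      ext w
      simp only [Set.mem_ofPred_eq]
      rw [show n + (m + 1) = n + 1 + m by ring, ← and_assoc]
      refine and_congr_left' ⟨?_, fun h1 => ⟨fun k hk => ?_, ?_⟩⟩
      · rintro ⟨h1, h2⟩ k hk
        rcases hk.lt_or_eq with hlt | rfl
        · rw [Function.update_of_ne (by omega)]
          exact h1 k (by omega)
        · rw [Function.update_self, h2]
      · rw [h1 k (by omega), Function.update_of_ne (by omega)]
      · rw [h1 (n + 1) le_rfl, Function.update_self]
    have hmeas : ∀ a : ℕ, MeasurableSet {w : Walk | (∀ k ≤ n, w.1 k = l k) ∧ w.1 (n + 1) = a ∧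
        ∀ k ≤ s, w.1 (n + (m + 1) + k) = l' k} := by
      intro a
      have : {w : Walk | (∀ k ≤ n, w.1 k = l k) ∧ w.1 (n + 1) = a ∧
          ∀ k ≤ s, w.1 (n + (m + 1) + k) = l' k} =
          {w | ∀ k ≤ n, w.1 k = l k} ∩ ((fun w => w.1 (n + 1)) ⁻¹' {a} ∩
            ⋂ k, ⋂ _ : k ≤ s, (fun w => w.1 (n + (m + 1) + k)) ⁻¹' {l' k}) := by
        ext w
        simp
      rw [this]
      exact (measurableSet_walk_prefix n l).inter
        ((measurable_walk_apply _ (measurableSet_singleton _)).inter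
          (MeasurableSet.iInter fun k => MeasurableSet.iInter fun _ =>
            measurable_walk_apply _ (measurableSet_singleton _)))
    have hset : {w : Walk | (∀ k ≤ n, w.1 k = l k) ∧ ∀ k ≤ s, w.1 (n + (m + 1) + k) = l' k} =
        {w | (∀ k ≤ n, w.1 k = l k) ∧ w.1 (n + 1) = l n + 1 ∧
          ∀ k ≤ s, w.1 (n + (m + 1) + k) = l' k} ∪
        {w | (∀ k ≤ n, w.1 k = l k) ∧ w.1 (n + 1) = l n - 1 ∧
          ∀ k ≤ s, w.1 (n + (m + 1) + k) = l' k} := by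
      ext w
      simp only [Set.mem_ofPred_eq, Set.mem_union]
      constructor
      · rintro ⟨h1, h2⟩
        have h3 := w.2.2 n
        rw [h1 n le_rfl] at h3
        rcases h3 with h3 | h3
        · exact Or.inl ⟨h1, h3, h2⟩
        · exact Or.inr ⟨h1, by omega, h2⟩
      · rintro (⟨h1, -, h2⟩ | ⟨h1, -, h2⟩) <;> exact ⟨h1, h2⟩
    rw [hset, measureReal_union (Set.disjoint_left.2 fun w hw hw' => by
        have h1 := hw.2.1
        have h2 := hw'.2.1
        omega) (hmeas _), hstep, hstep, walkProb]
    ring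

theorem walkLaw_return (p : ℕ) : walkLaw.real {w | w.1 (2 * p) = 0} = returnProb p := by
  have h := walkLaw_joint 0 (2 * p) 0 (fun _ => 0) (fun _ => 0) rfl
  simp only [Finset.range_zero, Finset.prod_empty, one_mul, mul_one] at h
  rw [returnProb, ← h]
  congr 1
  ext w
  simp [w.2.1]

/-! ### The two-sided walk and the existence of `B_∞`. -/

namespace PosTreedBridge

/-- The two-sided path made of two walks. -/
def glue (v : Walk × Walk) : Path ⊤ :=
  ⟨fun i => if 0 ≤ i then v.1.1 i.toNat else v.2.1 (-i).toNat, by simp [v.1.2.1], fun i => by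
    beta_reduce
    rcases lt_trichotomy i (-1) with h | rfl | h
    · rw [if_neg (by omega), if_neg (by omega)]
      have := v.2.2.2 (-(i + 1)).toNat
      rw [show (-(i + 1)).toNat + 1 = (-i).toNat by omega] at this
      omega
    · have := v.2.2.2 0
      simp [v.1.2.1, v.2.2.1] at this ⊢
      omega
    · rw [if_pos (by omega), if_pos (by omega)]
      have := v.1.2.2 i.toNat
      rwa [show i.toNat + 1 = (i + 1).toNat by omega] at this,
    fun p hp => absurd hp (by simp)⟩

theorem glue_natCast (v : Walk × Walk) (n : ℕ) : (glue v).1 n = v.1.1 n := by simp [glue]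

theorem glue_neg_natCast (v : Walk × Walk) (n : ℕ) : (glue v).1 (-(n : ℤ)) = v.2.1 n := by
  cases n with
  | zero => simp [glue, v.1.2.1, v.2.2.1]
  | succ n =>
    change (if 0 ≤ -((n + 1 : ℕ) : ℤ) then v.1.1 (-((n + 1 : ℕ) : ℤ)).toNat else v.2.1 (- -((n + 1 : ℕ) : ℤ)).toNat) = _
    rw [if_neg (by omega), neg_neg, Int.toNat_natCast]

theorem measurable_glue : Measurable glue := by
  refine Measurable.subtype_mk (measurable_pi_lambda _ fun i => ?_)
  by_cases h : 0 ≤ i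
  · simp only [h, if_true]
    exact (measurable_walk_apply _).comp measurable_fst
  · simp only [h, if_false]
    exact (measurable_walk_apply _).comp measurable_snd

/-- The law of a two-sided walk. -/
noncomputable def twoSidedLaw : Measure (Path ⊤) := (walkLaw.prod walkLaw).map glue

instance : IsProbabilityMeasure twoSidedLaw :=
  Measure.isProbabilityMeasure_map measurable_glue.aemeasurable

theorem _root_.IsPWalk.map {Ω Ω' : Type*} [MeasurableSpace Ω] [MeasurableSpace Ω'] {μ : Measure Ω}
    {f : Ω → Ω'} (hf : Measurable f) {Y : ℕ → Ω' → ℕ} (hY : ∀ n, Measurable (Y n))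
    (h : IsPWalk μ fun n ω => Y n (f ω)) : IsPWalk (μ.map f) Y := by
  refine ⟨hY, fun n l => ?_⟩
  have hm : MeasurableSet {ω | ∀ k ≤ n, Y k ω = l k} :=
    measurable_pi_lambda (fun ω k => Y k ω) hY (measurableSet_forall_le_eq n l)
  rw [map_measureReal_apply hf hm]
  exact h.2 n l

theorem _root_.IsPWalk.comp {Ω Ω' : Type*} [MeasurableSpace Ω] [MeasurableSpace Ω'] {μ : Measure Ω}
    {ν : Measure Ω'} {f : Ω → Ω'} (hf : MeasurePreserving f μ ν) {Y : ℕ → Ω' → ℕ}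
    (h : IsPWalk ν Y) : IsPWalk μ fun n ω => Y n (f ω) := by
  refine ⟨fun n => (h.1 n).comp hf.measurable, fun n l => ?_⟩
  have hm : MeasurableSet {ω | ∀ k ≤ n, Y k ω = l k} :=
    measurable_pi_lambda (fun ω k => Y k ω) h.1 (measurableSet_forall_le_eq n l)
  rw [← h.2 n l, ← hf.measureReal_preimage hm.nullMeasurableSet]
  rfl

theorem _root_.ProbabilityTheory.indepFun_map_iff {Ω Ω' β γ : Type*} [MeasurableSpace Ω]
    [MeasurableSpace Ω'] [MeasurableSpace β] [MeasurableSpace γ] {μ : Measure Ω} {f : Ω → Ω'}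
    (hf : Measurable f) {X : Ω' → β} {Y : Ω' → γ} (hX : Measurable X) (hY : Measurable Y) :
    IndepFun X Y (μ.map f) ↔ IndepFun (fun ω => X (f ω)) (fun ω => Y (f ω)) μ := by
  rw [indepFun_iff_measure_inter_preimage_eq_mul, indepFun_iff_measure_inter_preimage_eq_mul]
  refine forall₄_congr fun s t hs ht => ?_
  rw [Measure.map_apply hf ((hX hs).inter (hY ht)), Measure.map_apply hf (hX hs),
    Measure.map_apply hf (hY ht)]
  rfl

theorem isPWalk_twoSided_right : IsPWalk twoSidedLaw fun i x => x.1 (i : ℤ) := by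
  refine IsPWalk.map measurable_glue (fun n => measurable_path_apply _) ?_
  simp only [glue_natCast]
  exact isPWalk_walkLaw.comp measurePreserving_fst

theorem isPWalk_twoSided_left : IsPWalk twoSidedLaw fun i x => x.1 (-(i : ℤ)) := by
  refine IsPWalk.map measurable_glue (fun n => measurable_path_apply _) ?_
  simp only [glue_neg_natCast]
  exact isPWalk_walkLaw.comp measurePreserving_snd

theorem indepFun_twoSided : IndepFun (fun (x : Path ⊤) (i : ℕ) => x.1 (i : ℤ))
    (fun x (i : ℕ) => x.1 (-(i : ℤ))) twoSidedLaw := by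
  have h1 : Measurable fun (x : Path ⊤) (i : ℕ) => x.1 (i : ℤ) :=
    measurable_pi_lambda _ fun i => measurable_path_apply _
  have h2 : Measurable fun (x : Path ⊤) (i : ℕ) => x.1 (-(i : ℤ)) :=
    measurable_pi_lambda _ fun i => measurable_path_apply _
  rw [twoSidedLaw, indepFun_map_iff measurable_glue h1 h2]
  have := indepFun_prod (μ := walkLaw) (ν := walkLaw) (X := fun w : Walk => w.1)
    (Y := fun w : Walk => w.1) measurable_subtype_coe measurable_subtype_coe
  convert this using 1
  · ext v i
    exact glue_natCast v i
  · ext v i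
    exact glue_neg_natCast v i

theorem isLawOfBInfinity_bridgeLaw (hP : (⊤ : ℕ∞) ≠ 0) :
    IsLawOfBInfinity (bridgeLaw hP twoSidedLaw) where
  right_walk := by
    refine IsPWalk.map (measurable_treed hP)
      (fun n => (measurable_label _).comp measurable_subtype_coe) ?_
    exact isPWalk_twoSided_right.comp measurePreserving_fst
  left_walk := by
    refine IsPWalk.map (measurable_treed hP)
      (fun n => (measurable_label _).comp measurable_subtype_coe) ?_
    exact isPWalk_twoSided_left.comp measurePreserving_fst
  indep := by
    have h1 : Measurable fun (B : OfHalfLength ⊤) (i : ℕ) => B.1.label (i : ℤ) :=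
      measurable_pi_lambda _ fun i => (measurable_label _).comp measurable_subtype_coe
    have h2 : Measurable fun (B : OfHalfLength ⊤) (i : ℕ) => B.1.label (-(i : ℤ)) :=
      measurable_pi_lambda _ fun i => (measurable_label _).comp measurable_subtype_coe
    have h1' : Measurable fun (x : Path ⊤) (i : ℕ) => x.1 (i : ℤ) :=
      measurable_pi_lambda _ fun i => measurable_path_apply _
    have h2' : Measurable fun (x : Path ⊤) (i : ℕ) => x.1 (-(i : ℤ)) :=
      measurable_pi_lambda _ fun i => measurable_path_apply _
    rw [bridgeLaw, indepFun_map_iff (measurable_treed hP) h1 h2]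
    have hfst : MeasurePreserving Prod.fst (twoSidedLaw.prod treeFieldLaw) twoSidedLaw :=
      measurePreserving_fst
    have h := indepFun_twoSided
    rw [← hfst.map_eq, indepFun_map_iff measurable_fst h1' h2'] at h
    exact h
  trees := bridgeLaw_trees hP twoSidedLaw

end PosTreedBridge

/-! ### Closed walks and their local limit. -/

namespace PosTreedBridge

/-- The walk that alternates between `0` and `1`. -/
def zigzag : Walk :=
  ⟨fun k => k % 2, rfl, fun i => by
    beta_reduce
    omega⟩

/-- The walk itself if it is at `0` at time `2 p`, and otherwise a zigzag. -/
def closeWalk (p : ℕ) (w : Walk) : Walk :=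
  if w.1 (2 * p) = 0 then w else zigzag

theorem closeWalk_end (p : ℕ) (w : Walk) : (closeWalk p w).1 (2 * p) = 0 := by
  unfold closeWalk
  split_ifs with h
  · exact h
  · simp [zigzag]

/-- The periodic path that runs through the first `2 p` steps of the closed walk. -/
def periodize {p : ℕ} (hp : 0 < p) (w : Walk) : Path p :=
  ⟨fun i => (closeWalk p w).1 (i % (2 * p : ℤ)).toNat, by simp [(closeWalk p w).2.1], fun i => by
    beta_reduce
    have h0 := Int.emod_nonneg i (show (2 * p : ℤ) ≠ 0 by omega)
    have h1 := Int.emod_lt_of_pos i (show (0 : ℤ) < 2 * p by omega)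
    have hs := (closeWalk p w).2.2 (i % (2 * p : ℤ)).toNat
    have he : (i + 1) % (2 * p : ℤ) = (i % (2 * p : ℤ) + 1) % (2 * p : ℤ) := by simp
    rcases (Int.add_one_le_iff.2 h1).lt_or_eq with hlt | heq
    · rw [Int.emod_eq_of_lt (by omega) hlt] at he
      rwa [he, show (i % (2 * p : ℤ) + 1).toNat = (i % (2 * p : ℤ)).toNat + 1 by omega]
    · rw [heq, Int.emod_self] at he
      rw [show (i % (2 * p : ℤ)).toNat + 1 = 2 * p by omega, closeWalk_end] at hs
      rwa [he, Int.toNat_zero, (closeWalk p w).2.1], fun q hq i => by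
    obtain rfl : p = q := by exact_mod_cast hq
    simp⟩

theorem periodize_apply {p : ℕ} (hp : 0 < p) (w : Walk) (i : ℤ) :
    (periodize hp w).1 i = (closeWalk p w).1 (i % (2 * p : ℤ)).toNat := rfl

theorem periodize_natCast {p : ℕ} (hp : 0 < p) {w : Walk} (hw : w.1 (2 * p) = 0) {k : ℕ}
    (hk : k ≤ 2 * p) : (periodize hp w).1 k = w.1 k := by
  rw [periodize_apply, closeWalk, if_pos hw]
  rcases hk.lt_or_eq with h | rfl
  · rw [Int.emod_eq_of_lt (by omega) (by omega), Int.toNat_natCast]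
  · push_cast
    rw [Int.emod_self, Int.toNat_zero, hw, w.2.1]

theorem periodize_neg {p : ℕ} (hp : 0 < p) {w : Walk} (hw : w.1 (2 * p) = 0) {k : ℕ}
    (hk : k ≤ 2 * p) : (periodize hp w).1 (-(k : ℤ)) = w.1 (2 * p - k) := by
  rw [← (periodize hp w).2.2.2 p rfl, ← periodize_natCast hp hw (Nat.sub_le _ _),
    show -(k : ℤ) + 2 * p = ((2 * p - k : ℕ) : ℤ) by omega]

theorem measurable_periodize {p : ℕ} (hp : 0 < p) : Measurable (periodize hp) := by
  have h : Measurable (closeWalk p) := by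
    refine Measurable.ite (measurable_walk_apply _ (measurableSet_singleton 0)) measurable_id
      measurable_const
  exact Measurable.subtype_mk (measurable_pi_lambda _ fun i => (measurable_walk_apply _).comp h)

/-- The law of the walk conditioned to be at `0` at time `2 p`. -/
noncomputable def loopLaw {p : ℕ} (hp : 0 < p) : Measure (Path p) :=
  (walkLaw[|{w | w.1 (2 * p) = 0}]).map (periodize hp)

theorem walkLaw_return_ennreal (p : ℕ) :
    walkLaw {w | w.1 (2 * p) = 0} = ENNReal.ofReal (returnProb p) := by
  rw [← walkLaw_return, ofReal_measureReal]

instance {p : ℕ} (hp : 0 < p) : IsProbabilityMeasure (loopLaw hp) := by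
  have : IsProbabilityMeasure (walkLaw[|{w : Walk | w.1 (2 * p) = 0}]) := by
    refine cond_isProbabilityMeasure ?_
    rw [walkLaw_return_ennreal]
    exact (ENNReal.ofReal_pos.2 (returnProb_pos p)).ne'
  exact Measure.isProbabilityMeasure_map (measurable_periodize hp).aemeasurable

/-- The conditional law charges only the walks that are at `0` at time `2 p`, so the zigzag in
`closeWalk` never contributes; it only makes `periodize` defined everywhere. -/
theorem loopLaw_apply {p : ℕ} (hp : 0 < p) {s : Set (Path p)} (hs : MeasurableSet s) {a : ℝ}
    (h : walkLaw.real {w | w.1 (2 * p) = 0 ∧ periodize hp w ∈ s} = a) :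
    loopLaw hp s = ENNReal.ofReal (a / returnProb p) := by
  rw [loopLaw, Measure.map_apply (measurable_periodize hp) hs,
    cond_apply (show MeasurableSet {w : Walk | w.1 (2 * p) = 0} from
      measurable_walk_apply _ (measurableSet_singleton 0)), walkLaw_return_ennreal,
    ENNReal.ofReal_div_of_pos (returnProb_pos p), ← h, ofReal_measureReal, ENNReal.div_eq_inv_mul]
  rfl

theorem loopLaw_path {p : ℕ} (hp : 0 < p) (c : Path p) : loopLaw hp {x | x.1 = c.1} =
    ENNReal.ofReal ((∏ i ∈ Finset.range (2 * p), transProb (c.1 i) (c.1 (i + 1))) /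
      returnProb p) := by
  have hm : MeasurableSet {x : Path p | x.1 = c.1} := by
    exact measurable_path_val (measurableSet_singleton c.1)
  refine loopLaw_apply hp hm ?_
  have h := isPWalk_walkLaw.2 (2 * p) fun k => c.1 k
  rw [if_pos (by simpa using c.2.1)] at h
  simp only [Nat.cast_add, Nat.cast_one] at h
  rw [← h]
  congr 1
  ext w
  simp only [Set.mem_ofPred_eq]
  constructor
  · rintro ⟨h1, h2⟩ k hk
    rw [← periodize_natCast hp h1 hk, h2]
  · intro h2
    have h1 : w.1 (2 * p) = 0 := by
      rw [h2 _ le_rfl]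
      have := c.2.2.2 p rfl 0
      rw [zero_add, c.2.1] at this
      exact_mod_cast this
    refine ⟨h1, funext fun i => ?_⟩
    have hlt := Int.emod_lt_of_pos i (show (0 : ℤ) < 2 * p by omega)
    have hnn := Int.emod_nonneg i (show (2 * p : ℤ) ≠ 0 by omega)
    rw [periodize_apply, closeWalk, if_pos h1, h2 _ (by omega), Int.toNat_of_nonneg hnn]
    have hper : Function.Periodic c.1 (2 * p : ℤ) := c.2.2.2 p rfl
    conv_rhs => rw [← Int.emod_add_mul_ediv i (2 * p : ℤ), mul_comm (2 * p : ℤ) (i / _)]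
    exact (hper.int_mul _ _).symm

/-- By periodicity the window `[-n, n + 1]` consists of the first `n + 1` and the last `n` steps of
the loop. The remaining `2 p - (2 n + 1)` steps are unobserved. -/
theorem loopLaw_cylinder {p : ℕ} (hp : 0 < p) (n : ℕ) (hn : 2 * n + 1 ≤ 2 * p) (c : ℤ → ℕ)
    (hc : c 0 = 0) : loopLaw hp {x | x.1 ∈ cylinderSet (-n) (n + 1) c} =
    ENNReal.ofReal ((∏ k ∈ Finset.range (n + 1), transProb (c k) (c (k + 1))) *
      walkProb (2 * p - (2 * n + 1)) (c (n + 1)) (c (-n)) *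
      (∏ k ∈ Finset.range n, transProb (c (-n + k)) (c (-n + k + 1))) / returnProb p) := by
  refine loopLaw_apply hp (measurable_path_val (measurableSet_cylinderSet _ _ _)) ?_
  have h := walkLaw_joint n (2 * p - (2 * n + 1)) (n + 1) (fun k => c k) (fun k => c (-n + k))
    (by simpa using hc)
  simp only [Nat.cast_add, Nat.cast_one, Nat.cast_zero, add_zero, ← add_assoc] at h
  rw [← h]
  congr 1
  ext w
  have hcyl := mem_cylinderSet_neg_iff (a := n) (b := n + 1) (x := (periodize hp w).1) (c := c)
  push_cast at hcyl
  simp only [Set.mem_ofPred_eq]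
  change _ ∧ (periodize hp w).1 ∈ cylinderSet (-n) (n + 1) c ↔ _
  rw [hcyl]
  constructor
  · rintro ⟨h1, h2, h3⟩
    refine ⟨fun k hk => ?_, fun k hk => ?_⟩
    · rw [← periodize_natCast hp h1 (by omega), h2 k hk]
    · have := h3 (n - k) (by omega)
      rw [periodize_neg hp h1 (by omega)] at this
      rw [show n + 1 + (2 * p - (2 * n + 1)) + k = 2 * p - (n - k) by omega, this]
      congr 1
      omega
  · rintro ⟨h2, h3⟩
    have h1 : w.1 (2 * p) = 0 := by
      have := h3 n le_rfl
      rwa [neg_add_cancel, hc,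
        show n + 1 + (2 * p - (2 * n + 1)) + n = 2 * p by omega] at this
    refine ⟨h1, fun k hk => ?_, fun k hk => ?_⟩
    · rw [periodize_natCast hp h1 (by omega), h2 k hk]
    · have := h3 (n - k) (by omega)
      rw [periodize_neg hp h1 (by omega),
        show 2 * p - k = n + 1 + (2 * p - (2 * n + 1)) + (n - k) by omega, this]
      congr 1
      omega

/-- Reversing a stretch of path that ends at time `0`. -/
theorem prod_transProb_reverse (n : ℕ) (c : ℤ → ℕ)
    (hs : ∀ i, c (i + 1) = c i + 1 ∨ c i = c (i + 1) + 1) :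
    revMeasure (c (-n)) * ∏ k ∈ Finset.range n, transProb (c (-n + k)) (c (-n + k + 1)) =
      revMeasure (c 0) * ∏ k ∈ Finset.range n, transProb (c (-k)) (c (-(k + 1))) := by
  induction n with
  | zero => simp
  | succ n ih =>
    rw [Finset.prod_range_succ', Finset.prod_range_succ, ← mul_assoc (revMeasure (c 0)), ← ih]
    have h1 : ∀ k : ℕ, -((n + 1 : ℕ) : ℤ) + ((k + 1 : ℕ) : ℤ) = -n + k := fun k => by
      push_cast; ring
    simp only [h1]
    -- Detailed balance for the new leftmost step; the induction chains these identities from `0` to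
    -- `-n`.
    have h2 := detailed_balance_of_adj (hs (-((n + 1 : ℕ) : ℤ)))
    rw [show -((n + 1 : ℕ) : ℤ) + 1 = -n by push_cast; ring] at h2
    rw [Nat.cast_zero, add_zero, show -((n + 1 : ℕ) : ℤ) + 1 = -n by push_cast; ring]
    rw [show -((n : ℤ) + 1) = -((n + 1 : ℕ) : ℤ) by push_cast; ring]
    linear_combination (∏ k ∈ Finset.range n, transProb (c (-n + k)) (c (-n + k + 1))) * h2

theorem even_label_add (c : ℤ → ℕ) (hc : c 0 = 0)
    (hs : ∀ i, c (i + 1) = c i + 1 ∨ c i = c (i + 1) + 1) (i : ℤ) : Even ((c i : ℤ) + i) := by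
  induction i using Int.induction_on with
  | zero => simp [hc]
  | succ n ih =>
    have := hs n
    rw [Int.even_iff] at ih ⊢
    omega
  | pred n ih =>
    have := hs (-n - 1)
    rw [sub_add_cancel] at this
    rw [Int.even_iff] at ih ⊢
    omega

theorem twoSidedLaw_cylinder (n : ℕ) (c : ℤ → ℕ) (hc : c 0 = 0) :
    twoSidedLaw {x | x.1 ∈ cylinderSet (-n) (n + 1) c} = ENNReal.ofReal
      ((∏ k ∈ Finset.range (n + 1), transProb (c k) (c (k + 1))) *
        ∏ k ∈ Finset.range n, transProb (c (-k)) (c (-(k + 1)))) := by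
  have := measure_cylinder_of_walks isPWalk_twoSided_right isPWalk_twoSided_left
    indepFun_twoSided n (n + 1) c hc
  exact_mod_cast this

/-- The unobserved stretch contributes `revMeasure (c (-n)) / revMeasure 0` in the limit. By
`prod_transProb_reverse` this turns the steps from `-n` to `0` into those of a walk issued from `0`
and read backwards. -/
theorem loopLaw_cylinder_tendsto (n : ℕ) (c : ℤ → ℕ) (hc : c 0 = 0)
    (hs : ∀ i, c (i + 1) = c i + 1 ∨ c i = c (i + 1) + 1) :
    Tendsto (fun p : ℕ => loopLaw p.succ_pos {x | x.1 ∈ cylinderSet (-n) (n + 1) c}) atTop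
      (𝓝 (twoSidedLaw {x | x.1 ∈ cylinderSet (-n) (n + 1) c})) := by
  -- Labels have the parity of their index, as the ratio limit requires.
  have hpar : Even (c (n + 1) + c (-n) + (2 * n + 1)) := by
    have h1 := even_label_add c hc hs (n + 1)
    have h2 := even_label_add c hc hs (-n)
    rw [Int.even_iff] at h1 h2
    rw [Nat.even_iff]
    omega
  have hlim := (walkProb_ratio_tendsto_sub (c (n + 1)) (c (-n)) (2 * n + 1) hpar).comp
    (tendsto_add_atTop_nat 1)
  have hlim2 := (hlim.const_mul
    (∏ k ∈ Finset.range (n + 1), transProb (c k) (c (k + 1)))).mul_const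
    (∏ k ∈ Finset.range n, transProb (c (-n + k)) (c (-n + k + 1)))
  have hval : (∏ k ∈ Finset.range (n + 1), transProb (c k) (c (k + 1))) *
      (revMeasure (c (-n)) / revMeasure 0) *
      (∏ k ∈ Finset.range n, transProb (c (-n + k)) (c (-n + k + 1))) =
      (∏ k ∈ Finset.range (n + 1), transProb (c k) (c (k + 1))) *
        ∏ k ∈ Finset.range n, transProb (c (-k)) (c (-(k + 1))) := by
    have h := prod_transProb_reverse n c hs
    rw [hc] at h
    have := revMeasure_pos 0
    rw [mul_assoc, div_mul_eq_mul_div, h, mul_div_cancel_left₀ _ this.ne']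
  rw [hval] at hlim2
  rw [twoSidedLaw_cylinder n c hc]
  refine (ENNReal.tendsto_ofReal hlim2).congr' ?_
  filter_upwards [eventually_ge_atTop n] with p hp
  rw [loopLaw_cylinder p.succ_pos n (by omega) c hc]
  congr 1
  simp only [Function.comp_apply]
  ring

theorem bridgeLaw_cell_tendsto (n : ℕ) (C : PosTreedBridge) (hP : (⊤ : ℕ∞) ≠ 0)
    (hp : ∀ p : ℕ, ((p + 1 : ℕ) : ℕ∞) ≠ 0) :
    Tendsto (fun p : ℕ => bridgeLaw (hp p) (loopLaw p.succ_pos) (Subtype.val ⁻¹' cell n C)) atTop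
      (𝓝 (bridgeLaw hP twoSidedLaw (Subtype.val ⁻¹' cell n C))) := by
  rw [bridgeLaw_cell hP twoSidedLaw n (fun p hp => absurd hp (by simp)) C]
  have h := loopLaw_cylinder_tendsto n C.label C.label_zero C.label_step
  refine (ENNReal.Tendsto.mul_const h (Or.inr (measure_ne_top _ _))).congr' ?_
  filter_upwards [eventually_ge_atTop n] with p hpn
  refine (bridgeLaw_cell (hp p) (loopLaw p.succ_pos) n (fun q hq => ?_) C).symm
  have : p + 1 = q := by exact_mod_cast hq
  omega

/-! ### The Boltzmann law as a conditioned walk with independent trees. -/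

theorem weight_eq_prod {p : ℕ} (B : OfHalfLength p) : weight B =
    ∏ i ∈ Finset.range (2 * p), (B.1.tree i).elim 1 LTree.weight := by
  rw [weight, size, ← Finset.prod_pow_eq_pow_sum]
  refine Finset.prod_congr rfl fun i _ => ?_
  cases B.1.tree i with
  | none => simp
  | some t => rfl

/-- The Doob transform on a closed path gives a factor `weightFormula` at each down-step, which
cancels the normalisation of `rhoPlus` and leaves the plain weight of the tree. -/
theorem bridgeLaw_eq_mul_weight {p : ℕ} (hp : 0 < p) (hP : (p : ℕ∞) ≠ 0) (B : OfHalfLength p) :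
    bridgeLaw hP (loopLaw hp) {B} =
      ENNReal.ofReal ((√2 / 4) ^ (2 * p) / returnProb p) * weight B := by
  let c : Path p := ⟨B.1.label, B.1.label_zero, B.1.label_step,
    fun q hq => B.1.label_periodic q (B.2.trans hq)⟩
  have hpos := returnProb_pos p
  have h := prod_transProb_closed (fun i : ℕ => B.1.label i)
    (fun i => by simpa using B.1.label_step i) (2 * p) (by
      have := B.1.label_periodic p B.2 0
      simpa using this)
  simp only [Nat.cast_add, Nat.cast_one] at h
  rw [bridgeLaw_singleton hp, loopLaw_path hp c, weight_eq_prod]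
  change ENNReal.ofReal ((∏ i ∈ Finset.range (2 * p),
    transProb (B.1.label i) (B.1.label (i + 1))) / returnProb p) * _ = _
  rw [h, mul_div_right_comm, ENNReal.ofReal_mul (by positivity), mul_assoc,
    ENNReal.ofReal_prod_of_nonneg, ← Finset.prod_mul_distrib]
  · congr 1
    refine Finset.prod_congr rfl fun i _ => ?_
    split_ifs with hd
    · obtain ⟨t, ht, hBt⟩ := B.1.tree_of_down i hd
      obtain ⟨k, hk⟩ : ∃ k, B.1.label i = k + 1 := ⟨B.1.label i - 1, by omega⟩
      rw [hBt, Option.elim_some, Option.elim_some, ← LTree.totalWeight_eq, LTree.rhoPlus,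
        if_pos ht]
      refine ENNReal.mul_div_cancel ?_ (LTree.totalWeight_ne_top _)
      rw [hk]
      exact LTree.totalWeight_succ_ne_zero k
    · rw [B.1.tree_of_not_down _ hd]
      simp
  · intro i _
    split_ifs
    · exact LTree.weightFormula_nonneg _
    · exact zero_le_one

/-- Both are probabilities on a countable space with masses proportional to `weight`; total mass `1`
identifies the constant `K` as the inverse of the partition function. -/
theorem boltzmannLaw_eq_bridgeLaw {p : ℕ} (hp : 0 < p) (hP : (p : ℕ∞) ≠ 0) :
    boltzmannLaw p = bridgeLaw hP (loopLaw hp) := by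
  have := countable_ofHalfLength hp
  set K := ENNReal.ofReal ((√2 / 4) ^ (2 * p) / returnProb p) with hK
  have hK0 : K ≠ 0 := (ENNReal.ofReal_pos.2 (by have := returnProb_pos p; positivity)).ne'
  have hsum : K * ∑' B : OfHalfLength p, weight B = 1 := by
    rw [← ENNReal.tsum_mul_left, ← measure_univ (μ := bridgeLaw hP (loopLaw hp)),
      ← Measure.sum_smul_dirac (bridgeLaw hP (loopLaw hp)), Measure.sum_apply _ MeasurableSet.univ]
    refine tsum_congr fun B => ?_
    simp [bridgeLaw_eq_mul_weight hp hP B, hK]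
  rw [boltzmannLaw, ← Measure.sum_smul_dirac (bridgeLaw hP (loopLaw hp))]
  congr 1
  ext1 B
  rw [bridgeLaw_eq_mul_weight hp hP B, ← hK, div_eq_mul_inv, mul_comm K]
  congr 2
  exact (ENNReal.eq_inv_of_mul_eq_one_left hsum).symm

end PosTreedBridge

/-! ### The main theorem. -/

open PosTreedBridge

theorem mainTheorem9 :
    -- `B_p` is well defined: a walk conditioned to be at `0` at time `2 p`, with independent trees
    (∀ p : ℕ, 0 < p →
      IsProbabilityMeasure (PosTreedBridge.boltzmannLaw p) ∧
      ∀ B : PosTreedBridge.OfHalfLength p,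
        PosTreedBridge.boltzmannLaw p {B} =
          ENNReal.ofReal ((∏ i ∈ Finset.range (2 * p),
            transProb (B.1.label i) (B.1.label (i + 1))) / walkProb (2 * p) 0 0) *
          ∏ i ∈ Finset.range (2 * p), (B.1.tree i).elim 1 (LTree.rhoPlus (B.1.label i))) ∧
    -- the law of `B_∞` exists, is unique, and is the weak limit of those of `B_p`
    ∃ (μ : ℕ → ProbabilityMeasure PosTreedBridge)
      (μ' : ProbabilityMeasure (PosTreedBridge.OfHalfLength ⊤)),
      (∀ p : ℕ, 0 < p →
        (μ p : Measure PosTreedBridge) = (PosTreedBridge.boltzmannLaw p).map Subtype.val) ∧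
      IsLawOfBInfinity (μ' : Measure (PosTreedBridge.OfHalfLength ⊤)) ∧
      (∀ ν : ProbabilityMeasure (PosTreedBridge.OfHalfLength ⊤),
        IsLawOfBInfinity (ν : Measure (PosTreedBridge.OfHalfLength ⊤)) → ν = μ') ∧
      Tendsto μ atTop (𝓝 (μ'.map measurable_subtype_coe.aemeasurable)) := by
  have hne : ∀ {p : ℕ}, 0 < p → (p : ℕ∞) ≠ 0 := fun hp => by exact_mod_cast hp.ne'
  have htop : (⊤ : ℕ∞) ≠ 0 := by simp
  have hprob : ∀ {p : ℕ}, 0 < p → IsProbabilityMeasure (boltzmannLaw p) := fun hp => by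
    rw [boltzmannLaw_eq_bridgeLaw hp (hne hp)]
    infer_instance
  refine ⟨fun p hp => ⟨hprob hp, fun B => ?_⟩, ?_⟩
  · rw [boltzmannLaw_eq_bridgeLaw hp (hne hp), bridgeLaw_singleton hp]
    exact congrArg (· * _) (loopLaw_path hp ⟨B.1.label, B.1.label_zero, B.1.label_step,
      fun q hq => B.1.label_periodic q (B.2.trans hq)⟩)
  let μ' : ProbabilityMeasure (OfHalfLength ⊤) := ⟨bridgeLaw htop twoSidedLaw, inferInstance⟩
  have hlaw : IsLawOfBInfinity (μ' : Measure (OfHalfLength ⊤)) := isLawOfBInfinity_bridgeLaw htop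
  let μ : ℕ → ProbabilityMeasure PosTreedBridge := fun p =>
    if hp : 0 < p then
      ⟨(boltzmannLaw p).map Subtype.val, by
        have := hprob hp
        exact Measure.isProbabilityMeasure_map measurable_subtype_coe.aemeasurable⟩
    -- An arbitrary value at `p = 0`, where there is no bridge; the limit does not see it.
    else μ'.map measurable_subtype_coe.aemeasurable
  have hμ : ∀ p : ℕ, 0 < p →
      (μ p : Measure PosTreedBridge) = (boltzmannLaw p).map Subtype.val := fun p hp => by
    have h : μ p = ⟨(boltzmannLaw p).map Subtype.val, _⟩ := dif_pos hp
    rw [h]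
    rfl
  refine ⟨μ, μ', hμ, hlaw, fun ν hν => Subtype.ext (hν.unique hlaw), ?_⟩
  -- Convergence of the masses of the cells suffices: they are stable under intersection, and every
  -- open set contains a cell around each of its points.
  refine isPiSystem_cells.tendsto_probabilityMeasure_of_tendsto_of_mem ?_ ?_ ?_
  · rintro _ ⟨r, C, rfl⟩
    exact (isOpen_cell r C).measurableSet
  · intro G hG B hB
    obtain ⟨r, hr⟩ := isOpen_iff_agree.1 hG B hB
    exact ⟨_, ⟨r, B, rfl⟩, (isOpen_cell r B).mem_nhds (agree_refl r B), hr⟩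
  · rintro _ ⟨r, C, rfl⟩
    rw [← tendsto_add_atTop_iff_nat 1]
    have h := bridgeLaw_cell_tendsto r C htop fun p => hne p.succ_pos
    have hcell := (isOpen_cell r C).measurableSet
    rw [← ENNReal.tendsto_coe]
    simp only [ProbabilityMeasure.ennreal_coeFn_eq_coeFn_toMeasure]
    have h2 : ((μ'.map measurable_subtype_coe.aemeasurable : ProbabilityMeasure PosTreedBridge) :
        Measure PosTreedBridge) (cell r C) =
        bridgeLaw htop twoSidedLaw (Subtype.val ⁻¹' cell r C) := by
      exact Measure.map_apply measurable_subtype_coe hcell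
    rw [h2]
    refine h.congr fun p => ?_
    rw [hμ _ p.succ_pos, Measure.map_apply measurable_subtype_coe hcell,
      boltzmannLaw_eq_bridgeLaw p.succ_pos (hne p.succ_pos)]
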